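/- Let $\Lambda$ be an artin algebra, i.e. an algebra over a commutative artinian ring $R$ that is finitely generated as an $R$-module, and let $\mathrm{mod}\,\Lambda$ be the category of finitely generated left $\Lambda$-modules. Write $\mathrm{pd}\,M$ for the projective dimension of $M$, $\mathrm{soc}\,M$ for its socle, $\mathrm{add}\,L$ for the class of modules isomorphic to direct summands of finite direct sums of copies of $L$, and $\Omega^s(M)$ for the $s$-th syzygy of $M\in\mathrm{mod}\,\Lambda$ ($\Omega^0(M)=M$ and $\Omega^{s+1}(M)$ is the kernel of a projective cover of $\Omega^s(M)$). Put $$\mathrm{fin.dim.}\,\Lambda=\sup\{\mathrm{pd}\,M : M\in\mathrm{mod}\,\Lambda,\ \mathrm{pd}\,M<\infty\},$$ and let $\mathscr C(\Lambda)$ be the class of all indecomposable $C\in\mathrm{mod}\,\Lambda$ with $\mathrm{pd}\,C=\infty$ such that $C\in\mathrm{add}\,(M/\mathrm{soc}\,M)$ for some $M\in\mathrm{mod}\,\Lambda$ with $\mathrm{pd}\,M<\infty$. A class $\mathscr X$ of modules in $\mathrm{mod}\,\Lambda$ is of finite representation type if there is $L\in\mathrm{mod}\,\Lambda$ with $\mathscr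 X\subseteq\mathrm{add}\,L$. Then $\mathrm{fin.dim.}\,\Lambda<\infty$ if and only if there is an integer $s\ge 0$ such that $\Omega^s(\mathscr C(\Lambda))=\{\Omega^s(C): C\in\mathscr C(\Lambda)\}$ is of finite representation type. -/

import Mathlib

open CategoryTheory

universe u

noncomputable section

namespace ArtinAlg

/-- The socle of a module: the sum of all its simple submodules. -/
def socle (A : Type u) [Ring A] (M : Type u) [AddCommGroup M] [Module A M] : Submodule A M :=
  sSup {S : Submodule A M | IsSimpleModule A S}

/-- `add L`: the modules isomorphic to a direct summand of a finite direct sum of copies of `L`. -/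
def add {A : Type u} [Ring A] (L : ModuleCat.{u} A) : ObjectProperty (ModuleCat.{u} A) :=
  fun N => ∃ n : ℕ, Nonempty (Retract N (ModuleCat.of A (Fin n → L)))

/-- `f : P → M` is a projective cover in `mod A`: `P` is finitely generated projective and `f` is
surjective with superfluous kernel. -/
structure IsProjectiveCover {A : Type u} [Ring A] {P M : ModuleCat.{u} A} (f : P →ₗ[A] M) :
    Prop where
  finite : Module.Finite A P
  projective : Module.Projective A P
  surjective : Function.Surjective f
  superfluous : ∀ N : Submodule A P, N ⊔ LinearMap.ker f = ⊤ → N = ⊤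

/-- `N` is (isomorphic to) the syzygy `Ω M`, the kernel of a projective cover of `M`. -/
def IsSyzygy {A : Type u} [Ring A] (M N : ModuleCat.{u} A) : Prop :=
  ∃ (P : ModuleCat.{u} A) (f : P →ₗ[A] M),
    IsProjectiveCover f ∧ Nonempty (N ≃ₗ[A] LinearMap.ker f)

/-- The class `Ω 𝒳` of all syzygies of the modules in the class `𝒳`.
Its `s`-fold iterate is `Ω^s 𝒳`. -/
def syzygies {A : Type u} [Ring A] (X : ObjectProperty (ModuleCat.{u} A)) :
    ObjectProperty (ModuleCat.{u} A) :=
  fun N => ∃ M, X M ∧ IsSyzygy M N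

/-- A class of modules is of finite representation type if it is contained in `add L` for a
single finitely generated module `L`. -/
def IsOfFiniteRepresentationType {A : Type u} [Ring A] (X : ObjectProperty (ModuleCat.{u} A)) :
    Prop :=
  ∃ L : ModuleCat.{u} A, Module.Finite A L ∧ X ≤ add L

/-- `𝒫^{<∞}(A)`: the finitely generated modules of finite projective dimension. -/
def finitePD (A : Type u) [Ring A] : ObjectProperty (ModuleCat.{u} A) :=
  fun M => Module.Finite A M ∧ projectiveDimension M < ⊤

/-- `ind^∞(A)`: the indecomposable finitely generated modules of infinite projective dimension. -/
def indInfinitePD (A : Type u) [Ring A] : ObjectProperty (ModuleCat.{u} A) :=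
  fun M => Module.Finite A M ∧ Indecomposable M ∧ projectiveDimension M = ⊤

/-- The class `𝒞(A)`: the members of `ind^∞(A)` that lie in `add (M / soc M)` for some `M` in
`𝒫^{<∞}(A)`. -/
def classC (A : Type u) [Ring A] : ObjectProperty (ModuleCat.{u} A) :=
  fun C => indInfinitePD A C ∧
    ∃ M : ModuleCat.{u} A, finitePD A M ∧ add (ModuleCat.of A (M ⧸ socle A M)) C

/-- The finitistic dimension: the supremum of the projective dimensions of the finitely generated
modules of finite projective dimension. -/
def finDim (A : Type u) [Ring A] : WithBot ℕ∞ :=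
  sSup {d | ∃ M : ModuleCat.{u} A, finitePD A M ∧ projectiveDimension M = d}

end ArtinAlg

end

/-! Only left artinianness of `A` is used; write J for its radical. The link between the two
conditions is the sequence 0 → soc M → M → M/soc M → 0, where soc M lies in add(A/J), so the
syzygies of soc M are under control up to projective summands.

If all finite projective dimensions are below d, then Ω^d M is projective for M of finite projective
dimension. The d-th syzygy of the sequence thus presents Ω^d(soc M) as a (d+1)-st syzygy of M/soc M.
Hence Ω^(d+1) of every module in 𝒞 lies in add(Ω^d(A/J) ⊕ A).

Conversely, let Ω^s(𝒞) ⊆ add L and induct on k with J^k M = 0; as J is nilpotent this reaches all M.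
If J^(k+1) M = 0, then J^k kills M/soc M. Each indecomposable summand of M/soc M has finite
projective dimension, bounded by induction, or lies in 𝒞. A fixed syzygy of M/soc M therefore lies
in a fixed add L'. Rotating and taking syzygies yields a short exact sequence 0 → X → Y → Ω^t M → 0
with X, Y in the additive closure of one finitely generated module, independent of M.

The Igusa–Todorov argument (`exists_pd_bound_of_hasSES`) then bounds pd Ω^t M. By noetherianity of
ℤ^ι, adding a common summand to X and Y gives both a common N-th syzygy V, with N uniform. So 0 → V
→ V ⊕ P → Z' → 0 is exact with P projective, and Fitting's lemma bounds pd Z' by the projective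
dimension of a summand of V (`HasSES.exists_summand_pd`). Only finitely many indecomposables occur
in V, so this is uniform. -/

namespace ArtinAlg

/-! ### Short exact sequences and syzygies up to projective summands. -/

section Exact

variable {A : Type u} [Ring A]

/-- The product of two modules, as an object of the module category. -/
abbrev prodMod (X Y : ModuleCat.{u} A) : ModuleCat.{u} A := ModuleCat.of A (X × Y)

/-- The power `L ^ n`, as an object of the module category. -/
abbrev powMod (n : ℕ) (L : ModuleCat.{u} A) : ModuleCat.{u} A := ModuleCat.of A (Fin n → L)

/-- There is a short exact sequence `0 → X → Y → Z → 0`. -/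
def HasSES (X Y Z : ModuleCat.{u} A) : Prop :=
  ∃ (f : X →ₗ[A] Y) (g : Y →ₗ[A] Z),
    Function.Injective f ∧ Function.Exact f g ∧ Function.Surjective g

/-- A finitely generated projective module. -/
def FGProj (P : ModuleCat.{u} A) : Prop := Module.Finite A P ∧ Module.Projective A P

theorem FGProj.prod {P Q : ModuleCat.{u} A} (hP : FGProj P) (hQ : FGProj Q) :
    FGProj (prodMod P Q) := by
  obtain ⟨_, _⟩ := hP
  obtain ⟨_, _⟩ := hQ
  exact ⟨inferInstanceAs (Module.Finite A (P × Q)), inferInstanceAs (Module.Projective A (P × Q))⟩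

theorem FGProj.pow {P : ModuleCat.{u} A} (hP : FGProj P) (n : ℕ) : FGProj (powMod n P) := by
  obtain ⟨_, _⟩ := hP
  exact ⟨inferInstanceAs (Module.Finite A (Fin n → P)),
    Module.Projective.of_equiv (DFinsupp.linearEquivFunOnFintype (R := A) (M := fun _ : Fin n => P))⟩

theorem FGProj.self : FGProj (ModuleCat.of A A) :=
  ⟨inferInstanceAs (Module.Finite A A), inferInstanceAs (Module.Projective A A)⟩

theorem FGProj.of_subsingleton (P : ModuleCat.{u} A) [Subsingleton P] : FGProj P :=
  ⟨inferInstance, have := Module.Free.of_subsingleton A P; Module.Projective.of_free⟩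

theorem HasSES.congr {X Y Z X' Y' Z' : ModuleCat.{u} A} (h : HasSES X Y Z) (eX : X ≃ₗ[A] X')
    (eY : Y ≃ₗ[A] Y') (eZ : Z ≃ₗ[A] Z') : HasSES X' Y' Z' := by
  obtain ⟨f, g, hf, hfg, hg⟩ := h
  refine ⟨eY.toLinearMap ∘ₗ f ∘ₗ eX.symm.toLinearMap, eZ.toLinearMap ∘ₗ g ∘ₗ eY.symm.toLinearMap,
    ?_, ?_, ?_⟩
  · simpa using hf
  · intro y
    have := hfg (eY.symm y)
    simp only [LinearMap.coe_comp, LinearEquiv.coe_coe, Function.comp_apply,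
      LinearEquiv.map_eq_zero_iff, this, Set.mem_range]
    constructor
    · rintro ⟨x, hx⟩
      exact ⟨eX x, by simp [hx]⟩
    · rintro ⟨x, hx⟩
      exact ⟨eX.symm x, by simp [← hx]⟩
  · simpa using hg

theorem HasSES.prod {X Y Z X' Y' Z' : ModuleCat.{u} A} (h : HasSES X Y Z) (h' : HasSES X' Y' Z') :
    HasSES (prodMod X X') (prodMod Y Y') (prodMod Z Z') := by
  obtain ⟨f, g, hf, hfg, hg⟩ := h
  obtain ⟨f', g', hf', hfg', hg'⟩ := h'
  refine ⟨f.prodMap f', g.prodMap g', hf.prodMap hf', ?_, hg.prodMap hg'⟩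
  rintro ⟨y, y'⟩
  have h1 := hfg y
  have h2 := hfg' y'
  simp only [LinearMap.prodMap_apply, Prod.mk_eq_zero, h1, h2, Set.mem_range, Prod.exists,
    Prod.mk.injEq]
  exact ⟨fun ⟨⟨a, ha⟩, b, hb⟩ => ⟨a, b, ha, hb⟩, fun ⟨a, b, ha, hb⟩ => ⟨⟨a, ha⟩, b, hb⟩⟩

theorem HasSES.pow {X Y Z : ModuleCat.{u} A} (h : HasSES X Y Z) (n : ℕ) :
    HasSES (powMod n X) (powMod n Y) (powMod n Z) := by
  obtain ⟨f, g, hf, hfg, hg⟩ := h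
  refine ⟨f.compLeft (Fin n), g.compLeft (Fin n), hf.comp_left, ?_, hg.comp_left⟩
  intro y
  constructor
  · intro h
    choose x hx using fun i => (hfg (y i)).1 (congrFun h i)
    exact ⟨x, funext hx⟩
  · rintro ⟨x, rfl⟩
    exact funext fun i => (hfg _).2 ⟨x i, rfl⟩

theorem HasSES.inl_snd (X Y : ModuleCat.{u} A) : HasSES X (prodMod X Y) Y :=
  ⟨LinearMap.inl A X Y, LinearMap.snd A X Y, LinearMap.inl_injective, Function.Exact.inl_snd,
    LinearMap.snd_surjective⟩

theorem HasSES.ker {X Y : ModuleCat.{u} A} (f : X →ₗ[A] Y) (hf : Function.Surjective f) :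
    HasSES (ModuleCat.of A (LinearMap.ker f)) X Y :=
  ⟨(LinearMap.ker f).subtype, f, Subtype.val_injective, by
    intro y; simp, hf⟩

theorem HasSES.quotient (M : ModuleCat.{u} A) (N : Submodule A M) :
    HasSES (ModuleCat.of A N) M (ModuleCat.of A (M ⧸ N)) :=
  ⟨N.subtype, N.mkQ, Subtype.val_injective, by
    intro y; simp, N.mkQ_surjective⟩

theorem HasSES.finite_right {X Y Z : ModuleCat.{u} A} (h : HasSES X Y Z) [Module.Finite A Y] :
    Module.Finite A Z := by
  obtain ⟨f, g, hf, hfg, hg⟩ := h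
  exact Module.Finite.of_surjective g hg

theorem HasSES.finite_left [IsNoetherianRing A] {X Y Z : ModuleCat.{u} A} (h : HasSES X Y Z)
    [Module.Finite A Y] : Module.Finite A X := by
  obtain ⟨f, g, hf, hfg, hg⟩ := h
  exact Module.Finite.of_injective f hf

/-- Pulling back a short exact sequence along a projective presentation of its right end. -/
theorem HasSES.rotate {X Y Z Z' P : ModuleCat.{u} A} (h : HasSES X Y Z) (h' : HasSES Z' P Z)
    [Module.Projective A P] : HasSES Z' (prodMod X P) Y := by
  obtain ⟨f, g, hf, hfg, hg⟩ := h
  obtain ⟨k, q, hk, hkq, hq⟩ := h'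
  obtain ⟨s, hs⟩ := Module.projective_lifting_property g q hg
  have hs' : ∀ p, g (s p) = q p := fun p => LinearMap.congr_fun hs p
  have hfe : ∀ z, ((s ∘ₗ k) z) ∈ LinearMap.range f := by
    intro z
    refine (hfg _).1 ?_
    rw [LinearMap.comp_apply, hs']
    exact (hkq _).2 ⟨z, rfl⟩
  let t : Z' →ₗ[A] X :=
    (LinearEquiv.ofInjective f hf).symm.toLinearMap ∘ₗ (s ∘ₗ k).codRestrict _ hfe
  have ht : ∀ z, f (t z) = s (k z) := by
    intro z
    simp [t]
  refine ⟨(-t).prod k, f.coprod s, ?_, ?_, ?_⟩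
  · intro a b hab
    exact hk (congrArg Prod.snd hab)
  · rintro ⟨x, p⟩
    constructor
    · intro h
      have h0 : f x + s p = 0 := h
      have hp : q p = 0 := by
        rw [← hs', eq_neg_of_add_eq_zero_right h0, map_neg, neg_eq_zero]
        exact (hfg _).2 ⟨x, rfl⟩
      obtain ⟨z, rfl⟩ := (hkq p).1 hp
      refine ⟨z, ?_⟩
      have : f (-t z) = f x := by
        rw [map_neg, ht]
        exact (eq_neg_of_add_eq_zero_left h0).symm
      exact Prod.ext (hf this) rfl
    · rintro ⟨z, h⟩
      rw [← h]
      change f (-t z) + s (k z) = 0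
      rw [map_neg, ht, neg_add_cancel]
  · intro y
    obtain ⟨p, hp⟩ := hq (g y)
    obtain ⟨x, hx⟩ := (hfg (y - s p)).1 (by rw [map_sub, hs', hp, sub_self])
    exact ⟨(x, p), by change f x + s p = y; rw [hx, sub_add_cancel]⟩

theorem HasSES.split {X Y P : ModuleCat.{u} A} (h : HasSES X Y P) [Module.Projective A P] :
    Nonempty (prodMod X P ≃ₗ[A] Y) := by
  have h0 : HasSES (ModuleCat.of A PUnit.{u + 1}) P P :=
    ⟨0, LinearMap.id, Function.injective_of_subsingleton _, by intro y; simp [eq_comm],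
      Function.surjective_id⟩
  obtain ⟨f, g, hf, hfg, hg⟩ := h.rotate h0
  refine ⟨LinearEquiv.ofBijective g ⟨?_, hg⟩⟩
  rw [injective_iff_map_eq_zero]
  intro a ha
  obtain ⟨b, rfl⟩ := (hfg a).1 ha
  rw [Subsingleton.elim b 0, map_zero]

/-- `N` is the kernel of some surjection onto `K` from a finitely generated projective module. -/
def IsKerOfProj (K N : ModuleCat.{u} A) : Prop := ∃ P, FGProj P ∧ HasSES N P K

/-- `N` is an `n`-th syzygy of `M`, computed by an arbitrary resolution by finitely generated
projective modules. -/
def IsNthSyzygy : ℕ → ModuleCat.{u} A → ModuleCat.{u} A → Prop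
  | 0, M, N => Nonempty (M ≃ₗ[A] N)
  | n + 1, M, N => ∃ K, IsNthSyzygy n M K ∧ IsKerOfProj K N

theorem IsKerOfProj.finite {K N : ModuleCat.{u} A} (h : IsKerOfProj K N) : Module.Finite A K := by
  obtain ⟨P, ⟨_, _⟩, h⟩ := h
  exact h.finite_right

theorem IsKerOfProj.finite_ker [IsNoetherianRing A] {K N : ModuleCat.{u} A}
    (h : IsKerOfProj K N) : Module.Finite A N := by
  obtain ⟨P, ⟨_, _⟩, h⟩ := h
  exact h.finite_left

theorem IsKerOfProj.prod {K N K' N' : ModuleCat.{u} A} (h : IsKerOfProj K N)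
    (h' : IsKerOfProj K' N') : IsKerOfProj (prodMod K K') (prodMod N N') := by
  obtain ⟨P, hP, h⟩ := h
  obtain ⟨P', hP', h'⟩ := h'
  exact ⟨_, hP.prod hP', h.prod h'⟩

theorem IsKerOfProj.pow {K N : ModuleCat.{u} A} (h : IsKerOfProj K N) (n : ℕ) :
    IsKerOfProj (powMod n K) (powMod n N) := by
  obtain ⟨P, hP, h⟩ := h
  exact ⟨_, hP.pow n, h.pow n⟩

theorem IsKerOfProj.congr {K N K' N' : ModuleCat.{u} A} (h : IsKerOfProj K N)
    (eK : K ≃ₗ[A] K') (eN : N ≃ₗ[A] N') : IsKerOfProj K' N' := by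
  obtain ⟨P, hP, h⟩ := h
  exact ⟨_, hP, h.congr eN (LinearEquiv.refl A P) eK⟩

theorem IsKerOfProj.of_proj {P Q : ModuleCat.{u} A} (hP : FGProj P) (hQ : FGProj Q) :
    IsKerOfProj P Q :=
  ⟨_, hQ.prod hP, HasSES.inl_snd _ _⟩

/-- The zero module can be dropped from a product. -/
noncomputable def prodZeroEquiv (X Z : ModuleCat.{u} A) [Subsingleton Z] : prodMod X Z ≃ₗ[A] X :=
  LinearEquiv.ofBijective (LinearMap.fst A X Z)
    ⟨fun _ _ h => Prod.ext h (Subsingleton.elim _ _), LinearMap.fst_surjective⟩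

theorem IsKerOfProj.prod_right {K N P : ModuleCat.{u} A} (h : IsKerOfProj K N) (hP : FGProj P) :
    IsKerOfProj (prodMod K P) N :=
  (h.prod (IsKerOfProj.of_proj hP
    (FGProj.of_subsingleton (ModuleCat.of A PUnit.{u + 1})))).congr (LinearEquiv.refl A _)
    (prodZeroEquiv _ _)

/-- The zero module is also a quotient of `P`, with kernel `P`. Hence these syzygies are determined
only up to projective summands, which any later comparison must allow for. -/
theorem IsKerOfProj.prod_left {K N P : ModuleCat.{u} A} (h : IsKerOfProj K N) (hP : FGProj P) :
    IsKerOfProj K (prodMod N P) :=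
  (h.prod (IsKerOfProj.of_proj
    (FGProj.of_subsingleton (ModuleCat.of A PUnit.{u + 1})) hP)).congr
    (prodZeroEquiv _ _) (LinearEquiv.refl A _)

theorem exists_isKerOfProj (K : ModuleCat.{u} A) [Module.Finite A K] :
    ∃ N, IsKerOfProj K N := by
  obtain ⟨n, f, hf⟩ := Module.Finite.exists_fin' A K
  exact ⟨_, powMod n (ModuleCat.of A A), FGProj.self.pow n,
    HasSES.ker (X := powMod n (ModuleCat.of A A)) f hf⟩

theorem IsNthSyzygy.finite [IsNoetherianRing A] {n : ℕ} {M N : ModuleCat.{u} A}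
    (h : IsNthSyzygy n M N) [Module.Finite A M] : Module.Finite A N := by
  cases n with
  | zero => exact Module.Finite.equiv h.some
  | succ n => obtain ⟨K, _, h⟩ := h; exact h.finite_ker

theorem exists_isNthSyzygy [IsNoetherianRing A] (n : ℕ) (M : ModuleCat.{u} A)
    [Module.Finite A M] : ∃ N, IsNthSyzygy n M N := by
  induction n with
  | zero => exact ⟨M, ⟨LinearEquiv.refl A M⟩⟩
  | succ n ih =>
    obtain ⟨K, hK⟩ := ih
    have := hK.finite
    obtain ⟨N, hN⟩ := exists_isKerOfProj K
    exact ⟨N, K, hK, hN⟩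

theorem IsNthSyzygy.prod {n : ℕ} {M N M' N' : ModuleCat.{u} A} (h : IsNthSyzygy n M N)
    (h' : IsNthSyzygy n M' N') : IsNthSyzygy n (prodMod M M') (prodMod N N') := by
  induction n generalizing N N' with
  | zero => exact ⟨h.some.prodCongr h'.some⟩
  | succ n ih =>
    obtain ⟨K, hK, h⟩ := h
    obtain ⟨K', hK', h'⟩ := h'
    exact ⟨_, ih hK hK', h.prod h'⟩

theorem IsNthSyzygy.congr_left {n : ℕ} {M N M' : ModuleCat.{u} A} (h : IsNthSyzygy n M N)
    (e : M ≃ₗ[A] M') : IsNthSyzygy n M' N := by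
  induction n generalizing N with
  | zero => exact ⟨e.symm.trans h.some⟩
  | succ n ih =>
    obtain ⟨K, hK, h⟩ := h
    exact ⟨_, ih hK, h⟩

theorem IsNthSyzygy.congr_right {n : ℕ} {M N N' : ModuleCat.{u} A} (h : IsNthSyzygy n M N)
    (e : N ≃ₗ[A] N') : IsNthSyzygy n M N' := by
  cases n with
  | zero => exact ⟨h.some.trans e⟩
  | succ n =>
    obtain ⟨K, hK, h⟩ := h
    exact ⟨_, hK, h.congr (LinearEquiv.refl A K) e⟩

theorem IsNthSyzygy.trans {m n : ℕ} {M N K : ModuleCat.{u} A} (h : IsNthSyzygy m M N)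
    (h' : IsNthSyzygy n N K) : IsNthSyzygy (m + n) M K := by
  induction n generalizing K with
  | zero => exact h.congr_right h'.some
  | succ n ih =>
    obtain ⟨L, hL, h'⟩ := h'
    exact ⟨L, ih hL, h'⟩

theorem isNthSyzygy_one {M N : ModuleCat.{u} A} : IsNthSyzygy 1 M N ↔ IsKerOfProj M N :=
  ⟨fun ⟨_, ⟨e⟩, h⟩ => h.congr e.symm (LinearEquiv.refl A _),
    fun h => ⟨M, ⟨LinearEquiv.refl A M⟩, h⟩⟩

theorem IsNthSyzygy.exists_split {m n : ℕ} {M N : ModuleCat.{u} A}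
    (h : IsNthSyzygy (m + n) M N) : ∃ K, IsNthSyzygy m M K ∧ IsNthSyzygy n K N := by
  induction n generalizing N with
  | zero => exact ⟨N, h, ⟨LinearEquiv.refl A N⟩⟩
  | succ n ih =>
    obtain ⟨L, hL, h'⟩ := h
    obtain ⟨K, hK, hK'⟩ := ih hL
    exact ⟨K, hK, L, hK', h'⟩

theorem IsNthSyzygy.prod_fgProj {n : ℕ} {M N P : ModuleCat.{u} A} (h : IsNthSyzygy (n + 1) M N)
    (hP : FGProj P) : IsNthSyzygy (n + 1) M (prodMod N P) := by
  obtain ⟨K, hK, h⟩ := h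
  exact ⟨K, hK, h.prod_left hP⟩

/-- The horseshoe lemma, in the form of a triple rotation. -/
theorem HasSES.horseshoe {X Y Z X' Y' : ModuleCat.{u} A} [Module.Finite A Z] (h : HasSES X Y Z)
    (hX : IsKerOfProj X X') (hY : IsKerOfProj Y Y') :
    ∃ P Z', FGProj P ∧ HasSES X' (prodMod Y' P) Z' ∧ IsKerOfProj Z Z' := by
  obtain ⟨Z', hZ⟩ := exists_isKerOfProj Z
  have hZ₀ := hZ
  obtain ⟨P, hP, hZ⟩ := hZ
  obtain ⟨Q, hQ, hY⟩ := hY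
  have := hP.2
  have := hQ.2
  -- Successive rotations give Z' → X ⊕ P → Y, then Y' → Z' ⊕ Q → X ⊕ P, and finally X' → Y' ⊕ R →
  -- Z' ⊕ Q.
  have h1 := (h.rotate hZ).rotate hY
  obtain ⟨R, hR, hX⟩ := hX.prod_right hP
  have := hR.2
  exact ⟨R, _, hR, h1.rotate hX, hZ₀.prod_left hQ⟩

/-- The syzygies of `X` and `Y` are prescribed and only that of `Z` is constructed; this freedom
later allows the same module on the left and in the middle. The projective summand from each stage
is covered by itself, so it adds nothing to the next kernel. -/
theorem HasSES.horseshoe_iterate [IsNoetherianRing A] {n : ℕ} {X Y Z X' Y' : ModuleCat.{u} A}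
    [Module.Finite A Z] (h : HasSES X Y Z) (hX : IsNthSyzygy n X X') (hY : IsNthSyzygy n Y Y') :
    ∃ P Z', FGProj P ∧ HasSES X' (prodMod Y' P) Z' ∧ IsNthSyzygy n Z Z' := by
  induction n generalizing X' Y' with
  | zero =>
    exact ⟨ModuleCat.of A PUnit.{u + 1}, Z, FGProj.of_subsingleton _,
      h.congr hX.some (hY.some.trans (prodZeroEquiv _ _).symm) (LinearEquiv.refl A Z),
      ⟨LinearEquiv.refl A Z⟩⟩
  | succ n ih =>
    obtain ⟨X₁, hX₁, hX⟩ := hX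
    obtain ⟨Y₁, hY₁, hY⟩ := hY
    obtain ⟨P, Z₁, hP, hs, hZ₁⟩ := ih hX₁ hY₁
    have := hZ₁.finite
    obtain ⟨Q, Z', hQ, hs', hZ'⟩ := hs.horseshoe hX (hY.prod_right hP)
    exact ⟨Q, Z', hQ, hs', Z₁, hZ₁, hZ'⟩

end Exact

/-! ### Direct summands and additive closures. -/

section Add

variable {A : Type u} [Ring A]

/-- `X` is isomorphic to a direct summand of `Y`. -/
def IsSummand (X Y : ModuleCat.{u} A) : Prop :=
  ∃ (i : X →ₗ[A] Y) (r : Y →ₗ[A] X), r ∘ₗ i = LinearMap.id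

theorem isSummand_iff {X Y : ModuleCat.{u} A} : IsSummand X Y ↔ Nonempty (Retract X Y) := by
  constructor
  · rintro ⟨i, r, h⟩
    exact ⟨⟨ModuleCat.ofHom i, ModuleCat.ofHom r, by rw [← ModuleCat.ofHom_comp, h]; rfl⟩⟩
  · rintro ⟨h⟩
    exact ⟨h.i.hom, h.r.hom, by rw [← ModuleCat.hom_comp, h.retract]; rfl⟩

theorem add_iff {L N : ModuleCat.{u} A} : add L N ↔ ∃ n, IsSummand N (powMod n L) :=
  exists_congr fun _ => isSummand_iff.symm

theorem IsSummand.of_equiv {X Y : ModuleCat.{u} A} (e : X ≃ₗ[A] Y) : IsSummand X Y :=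
  ⟨e.toLinearMap, e.symm.toLinearMap, by ext; simp⟩

theorem IsSummand.refl (X : ModuleCat.{u} A) : IsSummand X X := .of_equiv (LinearEquiv.refl A X)

theorem IsSummand.trans {X Y Z : ModuleCat.{u} A} (h : IsSummand X Y) (h' : IsSummand Y Z) :
    IsSummand X Z := by
  obtain ⟨i, r, h⟩ := h
  obtain ⟨i', r', h'⟩ := h'
  refine ⟨i' ∘ₗ i, r ∘ₗ r', ?_⟩
  ext x
  exact (congrArg r (LinearMap.congr_fun h' (i x))).trans (LinearMap.congr_fun h x)

theorem IsSummand.prod {X Y X' Y' : ModuleCat.{u} A} (h : IsSummand X Y) (h' : IsSummand X' Y') :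
    IsSummand (prodMod X X') (prodMod Y Y') := by
  obtain ⟨i, r, h⟩ := h
  obtain ⟨i', r', h'⟩ := h'
  refine ⟨i.prodMap i', r.prodMap r', ?_⟩
  exact LinearMap.ext fun x =>
    Prod.ext (LinearMap.congr_fun h x.1) (LinearMap.congr_fun h' x.2)

theorem IsSummand.pow {X Y : ModuleCat.{u} A} (h : IsSummand X Y) (n : ℕ) :
    IsSummand (powMod n X) (powMod n Y) := by
  obtain ⟨i, r, h⟩ := h
  refine ⟨i.compLeft (Fin n), r.compLeft (Fin n), ?_⟩
  exact LinearMap.ext fun x => funext fun j => LinearMap.congr_fun h (x j)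

theorem IsSummand.fst (X Y : ModuleCat.{u} A) : IsSummand X (prodMod X Y) :=
  ⟨LinearMap.inl A X Y, LinearMap.fst A X Y, LinearMap.fst_comp_inl ..⟩

theorem IsSummand.snd (X Y : ModuleCat.{u} A) : IsSummand Y (prodMod X Y) :=
  ⟨LinearMap.inr A X Y, LinearMap.snd A X Y, LinearMap.snd_comp_inr ..⟩

theorem IsSummand.finite {X Y : ModuleCat.{u} A} (h : IsSummand X Y) [Module.Finite A Y] :
    Module.Finite A X := by
  obtain ⟨i, r, h⟩ := h
  exact Module.Finite.of_surjective r (Function.RightInverse.surjective (LinearMap.congr_fun h))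

theorem compl_equiv {X Y : ModuleCat.{u} A} {i : X →ₗ[A] Y} {r : Y →ₗ[A] X}
    (h : r ∘ₗ i = LinearMap.id) :
    Nonempty (prodMod X (ModuleCat.of A (LinearMap.ker r)) ≃ₗ[A] Y) := by
  have h' : ∀ x, r (i x) = x := LinearMap.congr_fun h
  refine ⟨LinearEquiv.ofBijective (i.coprod (LinearMap.ker r).subtype) ⟨?_, ?_⟩⟩
  · rw [injective_iff_map_eq_zero]
    rintro ⟨x, y, hy⟩ hxy
    have h0 : i x + y = 0 := hxy
    have hx : x = 0 := by
      have := congrArg r h0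
      rwa [map_add, h', LinearMap.mem_ker.1 hy, add_zero, map_zero] at this
    subst hx
    rw [map_zero, zero_add] at h0
    exact Prod.ext rfl (Subtype.ext h0)
  · intro y
    refine ⟨(r y, ⟨y - i (r y), by simp [h']⟩), ?_⟩
    change i (r y) + (y - i (r y)) = y
    abel

theorem IsSummand.exists_compl {X Y : ModuleCat.{u} A} (h : IsSummand X Y) :
    ∃ X' : ModuleCat.{u} A, Nonempty (prodMod X X' ≃ₗ[A] Y) := by
  obtain ⟨i, r, h⟩ := h
  exact ⟨_, compl_equiv h⟩

/-- `L ^ (m + n) ≃ L ^ m × L ^ n`. -/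
def powAddEquiv (m n : ℕ) (L : ModuleCat.{u} A) :
    powMod (m + n) L ≃ₗ[A] prodMod (powMod m L) (powMod n L) :=
  (LinearEquiv.funCongrLeft A L finSumFinEquiv).trans
    (LinearEquiv.sumArrowLequivProdArrow (Fin m) (Fin n) A L)

/-- `(L ^ m) ^ n ≃ L ^ (n * m)`. -/
def powPowEquiv (m n : ℕ) (L : ModuleCat.{u} A) :
    powMod n (powMod m L) ≃ₗ[A] powMod (n * m) L :=
  (LinearEquiv.curry A L (Fin n) (Fin m)).symm.trans
    (LinearEquiv.funCongrLeft A L finProdFinEquiv.symm)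

/-- `L ^ 1 ≃ L`. -/
def powOneEquiv (L : ModuleCat.{u} A) : powMod 1 L ≃ₗ[A] L := LinearEquiv.funUnique (Fin 1) A L

theorem add_self (L : ModuleCat.{u} A) : add L L :=
  add_iff.2 ⟨1, .of_equiv (powOneEquiv L).symm⟩

theorem add_of_isSummand {L M N : ModuleCat.{u} A} (h : IsSummand M N) (hN : add L N) :
    add L M := by
  obtain ⟨n, hn⟩ := add_iff.1 hN
  exact add_iff.2 ⟨n, h.trans hn⟩

theorem add_prod {L M N : ModuleCat.{u} A} (hM : add L M) (hN : add L N) :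
    add L (prodMod M N) := by
  obtain ⟨m, hm⟩ := add_iff.1 hM
  obtain ⟨n, hn⟩ := add_iff.1 hN
  exact add_iff.2 ⟨m + n, (hm.prod hn).trans (.of_equiv (powAddEquiv m n L).symm)⟩

theorem add_pow {L M : ModuleCat.{u} A} (hM : add L M) (n : ℕ) : add L (powMod n M) := by
  obtain ⟨m, hm⟩ := add_iff.1 hM
  exact add_iff.2 ⟨n * m, (hm.pow n).trans (.of_equiv (powPowEquiv m n L))⟩

theorem add_trans {L M N : ModuleCat.{u} A} (hM : add L M) (hN : add M N) : add L N := by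
  obtain ⟨n, hn⟩ := add_iff.1 hN
  exact add_of_isSummand hn (add_pow hM n)

theorem add_prod_left {L L' M : ModuleCat.{u} A} (h : add L M) : add (prodMod L L') M :=
  add_trans (add_of_isSummand (.fst L L') (add_self _)) h

theorem add_prod_right {L L' M : ModuleCat.{u} A} (h : add L' M) : add (prodMod L L') M :=
  add_trans (add_of_isSummand (.snd L L') (add_self _)) h

theorem finite_of_add {L M : ModuleCat.{u} A} (h : add L M) [Module.Finite A L] :
    Module.Finite A M := by
  obtain ⟨n, hn⟩ := add_iff.1 h
  have : Module.Finite A (powMod n L) := inferInstanceAs (Module.Finite A (Fin n → L))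
  exact hn.finite

theorem FGProj.mem_add {P : ModuleCat.{u} A} (hP : FGProj P) : add (ModuleCat.of A A) P := by
  obtain ⟨_, _⟩ := hP
  obtain ⟨n, f, hf⟩ := Module.Finite.exists_fin' A P
  obtain ⟨s, hs⟩ := Module.projective_lifting_property f LinearMap.id hf
  exact add_iff.2 ⟨n, s, f, hs⟩

/-- Schanuel's lemma: complete `M` to a power of `L` and compare two projective presentations of
that power. The summand `A` absorbs the projectives that appear. -/
theorem add_of_isKerOfProj {L L' M V : ModuleCat.{u} A} (hM : add L M) (hV : IsKerOfProj M V)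
    (hL : IsKerOfProj L L') : add (prodMod L' (ModuleCat.of A A)) V := by
  obtain ⟨n, hn⟩ := add_iff.1 hM
  obtain ⟨M', ⟨e⟩⟩ := hn.exists_compl
  have := hL.finite
  have : Module.Finite A (powMod n L) := inferInstanceAs (Module.Finite A (Fin n → L))
  have : Module.Finite A M' := ((IsSummand.snd M M').trans (.of_equiv e)).finite
  obtain ⟨V', hV'⟩ := exists_isKerOfProj M'
  obtain ⟨P, hP, h1⟩ := (hV.prod hV').congr e (LinearEquiv.refl A _)
  obtain ⟨Q, hQ, h2⟩ := hL.pow n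
  have := hP.2
  have := hQ.2
  obtain ⟨e'⟩ := (h2.rotate h1).split
  refine add_of_isSummand (((IsSummand.fst V V').trans (.fst _ Q)).trans (.of_equiv e')) ?_
  exact add_prod (add_prod_left (add_pow (add_self _) n)) (add_prod_right hP.mem_add)

theorem add_of_isNthSyzygy {n : ℕ} {L L' M V : ModuleCat.{u} A} (hM : add L M)
    (hV : IsNthSyzygy n M V) (hL : IsNthSyzygy n L L') :
    add (prodMod L' (ModuleCat.of A A)) V := by
  induction n generalizing V L' with
  | zero =>
    refine add_of_isSummand (.of_equiv hV.some.symm) (add_trans ?_ hM)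
    exact add_prod_left (add_of_isSummand (.of_equiv hL.some) (add_self _))
  | succ n ih =>
    obtain ⟨K, hK, hV⟩ := hV
    obtain ⟨K', hK', hL⟩ := hL
    exact add_of_isKerOfProj (ih hK hK') hV (hL.prod_right FGProj.self)

end Add

/-! ### Fitting's lemma, indecomposable decompositions and projective covers. -/

section KrullSchmidt

variable {A : Type u} [Ring A]

/-- Fitting's lemma: an endomorphism of a module of finite length is nilpotent on a direct summand
`W` and invertible on a complement of `W`. -/
theorem exists_fitting {M : ModuleCat.{u} A} [IsArtinian A M] [IsNoetherian A M]
    (f : Module.End A M) :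
    ∃ (W : ModuleCat.{u} A) (j : W →ₗ[A] M) (r : M →ₗ[A] W) (g : Module.End A M) (m : ℕ),
      r ∘ₗ j = LinearMap.id ∧ (f ^ m) ∘ₗ j = 0 ∧ f * g = 1 - j ∘ₗ r ∧ g * f = 1 - j ∘ₗ r := by
  obtain ⟨m, hm, hc⟩ := ((Filter.eventually_ge_atTop 1).and
    f.eventually_isCompl_ker_pow_range_pow).exists
  set K := LinearMap.ker (f ^ m)
  set R := LinearMap.range (f ^ m)
  set π := K.projectionOnto R hc
  let e : Module.End A M := K.subtype ∘ₗ π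
  have eK : ∀ x ∈ K, e x = x := fun x hx =>
    congrArg Subtype.val (Submodule.projectionOnto_apply_of_mem_left hc hx)
  have eR : ∀ x ∈ R, e x = 0 := fun x hx => by
    have : π x = 0 := (Submodule.projectionOnto_apply_eq_zero_iff hc).2 hx
    simp [e, this]
  have emem : ∀ x, e x ∈ K := fun x => (π x).2
  have fK : ∀ x ∈ K, f x ∈ K := fun x hx => by
    have : (f ^ m) (f x) = f ((f ^ m) x) := by
      rw [← Module.End.mul_apply, ← Module.End.mul_apply, ← pow_succ, ← pow_succ']
    rw [LinearMap.mem_ker, this, LinearMap.mem_ker.1 hx, map_zero]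
  have fR : ∀ x ∈ R, f x ∈ R := by
    rintro _ ⟨y, rfl⟩
    exact ⟨f y, by rw [← Module.End.mul_apply, ← Module.End.mul_apply, ← pow_succ, ← pow_succ']⟩
  have sub_mem : ∀ x, x - e x ∈ R := fun x =>
    (Submodule.projectionOnto_apply_eq_zero_iff hc).1
      (Subtype.ext (by change e (x - e x) = 0; rw [map_sub, eK _ (emem x), sub_self]))
  have hcomm : f * e = e * f := by
    refine LinearMap.ext fun x => ?_
    have h1 : e (f (x - e x)) = 0 := eR _ (fR _ (sub_mem x))
    rw [map_sub, map_sub, eK _ (fK _ (emem x)), sub_eq_zero] at h1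
    exact h1.symm
  have hfe : f ^ m * e = 0 := LinearMap.ext fun x => LinearMap.mem_ker.1 (emem x)
  have hef : e * f ^ m = 0 := LinearMap.ext fun x => eR _ ⟨x, rfl⟩
  have hee : e * e = e := LinearMap.ext fun x => eK _ (emem x)
  -- This sum is f^m on the range and the identity on the kernel, so it is invertible. Its inverse
  -- u⁻¹ yields g = f^(m-1) u⁻¹, which needs m ≥ 1.
  have hu : IsUnit (f ^ m + e) := by
    rw [Module.End.isUnit_iff]
    refine IsArtinian.bijective_of_injective_endomorphism _ ?_
    rw [injective_iff_map_eq_zero]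
    intro x hx
    have h0 : (f ^ m) x + e x = 0 := hx
    have h1 : e x = 0 := by
      have := congrArg e h0
      rwa [map_add, eR _ ⟨x, rfl⟩, zero_add, eK _ (emem x), map_zero] at this
    rw [h1, add_zero] at h0
    rw [← eK x h0, h1]
  obtain ⟨u, hu⟩ := hu
  have hv : Commute f (↑u⁻¹ : Module.End A M) :=
    Commute.units_inv_right (by rw [hu]; exact ((Commute.refl f).pow_right m).add_right hcomm)
  have hev : e * (↑u⁻¹ : Module.End A M) = e := by
    rw [Units.mul_inv_eq_iff_eq_mul, hu, mul_add, hef, hee, zero_add]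
  have hfv : f ^ m * (↑u⁻¹ : Module.End A M) = 1 - e := by
    have : f ^ m = ↑u - e := by rw [hu, add_sub_cancel_right]
    rw [this, sub_mul, Units.mul_inv, hev]
  refine ⟨ModuleCat.of A K, K.subtype, π, f ^ (m - 1) * ↑u⁻¹, m,
    Submodule.projectionOnto_comp_subtype hc, ?_, ?_, ?_⟩
  · exact LinearMap.ext fun x => LinearMap.mem_ker.1 x.2
  · rw [← mul_assoc, ← pow_succ', Nat.sub_add_cancel hm]
    exact hfv
  · rw [mul_assoc, ← hv.eq, ← mul_assoc, ← pow_succ, Nat.sub_add_cancel hm]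
    exact hfv

/-- A nonzero module that is not a direct sum of two nonzero modules. -/
def IsIndec (M : ModuleCat.{u} A) : Prop :=
  ¬ Subsingleton M ∧ ∀ X Y : ModuleCat.{u} A, Nonempty (prodMod X Y ≃ₗ[A] M) →
    Subsingleton X ∨ Subsingleton Y

theorem IsIndec.indecomposable {M : ModuleCat.{u} A} (h : IsIndec M) : Indecomposable M := by
  refine ⟨fun h0 => h.1 (ModuleCat.subsingleton_of_isZero h0), fun X Y e => ?_⟩
  rw [ModuleCat.isZero_iff_subsingleton, ModuleCat.isZero_iff_subsingleton]
  exact h.2 X Y ⟨(e.trans (ModuleCat.biprodIsoProd X Y)).symm.toLinearEquiv⟩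

theorem IsIndec.of_summand {M W : ModuleCat.{u} A} (h : IsIndec M) {j : W →ₗ[A] M}
    {r : M →ₗ[A] W} (hr : r ∘ₗ j = LinearMap.id) : Subsingleton W ∨ j ∘ₗ r = LinearMap.id := by
  refine (h.2 _ _ (compl_equiv hr)).imp id fun (h0 : Subsingleton (LinearMap.ker r)) => ?_
  have hinj : Function.Injective r := by
    rw [injective_iff_map_eq_zero]
    intro x hx
    exact congrArg Subtype.val (Subsingleton.elim (⟨x, hx⟩ : LinearMap.ker r) 0)
  exact LinearMap.ext fun x => hinj (LinearMap.congr_fun hr (r x))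

/-- The endomorphism ring is local: by Fitting, `a` is invertible or nilpotent, and in the latter
case `b = 1 - a` is invertible. -/
theorem IsIndec.isUnit_or_isUnit {M : ModuleCat.{u} A} [IsArtinian A M] [IsNoetherian A M]
    (h : IsIndec M) {a b : Module.End A M} (hab : a + b = 1) : IsUnit a ∨ IsUnit b := by
  obtain ⟨W, j, r, g, m, hrj, hj, h1, h2⟩ := exists_fitting a
  obtain h0 | h0 := h.of_summand hrj
  · left
    have : j ∘ₗ r = 0 := LinearMap.ext fun x => by
      rw [LinearMap.comp_apply, Subsingleton.elim (r x) 0, map_zero]; rfl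
    rw [this, sub_zero] at h1 h2
    exact ⟨⟨a, g, h1, h2⟩, rfl⟩
  · right
    have h3 : a ^ m = 0 := by
      have : ((a ^ m) ∘ₗ j) ∘ₗ r = 0 := by rw [hj, LinearMap.zero_comp]
      rwa [LinearMap.comp_assoc, h0, LinearMap.comp_id] at this
    rw [← eq_sub_iff_add_eq'] at hab
    rw [hab]
    exact IsNilpotent.isUnit_one_sub ⟨m, h3⟩

/-- The identity of `M` is the sum of an endomorphism through `X` and one through `Y`; by locality
one of them is a unit. -/
theorem IsIndec.isSummand_or {M X Y : ModuleCat.{u} A} [IsArtinian A M] [IsNoetherian A M]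
    (h : IsIndec M) (hM : IsSummand M (prodMod X Y)) : IsSummand M X ∨ IsSummand M Y := by
  obtain ⟨i, r, hir⟩ := hM
  have key : ∀ (Z : ModuleCat.{u} A) (p : M →ₗ[A] Z) (q : Z →ₗ[A] M),
      IsUnit (q ∘ₗ p : Module.End A M) → IsSummand M Z := by
    rintro Z p q ⟨v, hv⟩
    refine ⟨p, (↑v⁻¹ : Module.End A M) ∘ₗ q, ?_⟩
    rw [LinearMap.comp_assoc, ← hv]
    exact v.inv_mul
  have hab : ((r ∘ₗ LinearMap.inl A X Y) ∘ₗ (LinearMap.fst A X Y ∘ₗ i) : Module.End A M) +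
      ((r ∘ₗ LinearMap.inr A X Y) ∘ₗ (LinearMap.snd A X Y ∘ₗ i)) = 1 := by
    refine LinearMap.ext fun x => ?_
    change r ((i x).1, 0) + r (0, (i x).2) = x
    rw [← map_add]
    simpa using LinearMap.congr_fun hir x
  exact (h.isUnit_or_isUnit hab).imp (key X _ _) (key Y _ _)

theorem IsIndec.isSummand_of_add {M L : ModuleCat.{u} A} [IsArtinian A M] [IsNoetherian A M]
    (h : IsIndec M) (hM : add L M) : IsSummand M L := by
  obtain ⟨n, hn⟩ := add_iff.1 hM
  induction n with
  | zero =>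
    obtain ⟨i, r, hir⟩ := hn
    refine absurd ⟨fun x y => ?_⟩ h.1
    rw [← LinearMap.id_apply (R := A) x, ← LinearMap.id_apply (R := A) y, ← hir,
      LinearMap.comp_apply, LinearMap.comp_apply, Subsingleton.elim (i x) (i y)]
  | succ n ih =>
    obtain h' | h' := h.isSummand_or (hn.trans (.of_equiv (powAddEquiv n 1 L)))
    · exact ih h'
    · exact h'.trans (.of_equiv (powOneEquiv L))

/-- The direct sum of `a i` copies of `F i`, over all `i`. -/
abbrev multMod {ι : Type} (F : ι → ModuleCat.{u} A) (a : ι → ℕ) : ModuleCat.{u} A :=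
  ModuleCat.of A (∀ i, Fin (a i) → F i)

/-- The multiplicities of a direct sum add up. -/
def multAddEquiv {ι : Type} (F : ι → ModuleCat.{u} A) (a b : ι → ℕ) :
    multMod F (a + b) ≃ₗ[A] prodMod (multMod F a) (multMod F b) :=
  (LinearEquiv.piCongrRight fun i => powAddEquiv (a i) (b i) (F i)).trans
    { toFun := fun x => (fun i => (x i).1, fun i => (x i).2)
      invFun := fun x i => (x.1 i, x.2 i)
      left_inv := fun _ => rfl
      right_inv := fun _ => rfl
      map_add' := fun _ _ => rfl
      map_smul' := fun _ _ => rfl }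

theorem add_multMod {ι : Type} [Finite ι] {L : ModuleCat.{u} A} {F : ι → ModuleCat.{u} A}
    (hF : ∀ i, IsSummand (F i) L) (a : ι → ℕ) : add L (multMod F a) := by
  have := Fintype.ofFinite ι
  choose j r hjr using hF
  let e := Fintype.equivFin (Σ i, Fin (a i))
  refine add_iff.2 ⟨_,
    (LinearEquiv.funCongrLeft A L e.symm).toLinearMap ∘ₗ
      { toFun := fun x s => j s.1 (x s.1 s.2)
        map_add' := fun _ _ => funext fun _ => map_add _ _ _
        map_smul' := fun _ _ => funext fun _ => map_smul _ _ _ },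
    { toFun := fun y i t => r i (y ⟨i, t⟩)
      map_add' := fun _ _ => funext fun _ => funext fun _ => map_add _ _ _
      map_smul' := fun _ _ => funext fun _ => funext fun _ => map_smul _ _ _ } ∘ₗ
      (LinearEquiv.funCongrLeft A L e).toLinearMap, ?_⟩
  refine LinearMap.ext fun x => funext fun i => funext fun t => ?_
  change r i (j (e.symm (e ⟨i, t⟩)).1 (x (e.symm (e ⟨i, t⟩)).1 (e.symm (e ⟨i, t⟩)).2)) = x i t
  rw [e.symm_apply_apply]
  exact LinearMap.congr_fun (hjr i) (x i t)

theorem exists_multMod_single {ι : Type} [DecidableEq ι] (F : ι → ModuleCat.{u} A) (i : ι) :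
    Nonempty (multMod F (Pi.single i 1) ≃ₗ[A] F i) := by
  have hi : 0 < (Pi.single i 1 : ι → ℕ) i := by simp
  let f : multMod F (Pi.single i 1) →ₗ[A] F i :=
    { toFun := fun x => x i ⟨0, hi⟩
      map_add' := fun _ _ => rfl
      map_smul' := fun _ _ => rfl }
  refine ⟨LinearEquiv.ofBijective f ⟨?_, ?_⟩⟩
  · intro x y hxy
    funext j t
    by_cases hj : j = i
    · subst hj
      have ht : t = ⟨0, hi⟩ := by
        have := t.2
        simp only [Pi.single_eq_same] at this
        exact Fin.ext (by simpa using this)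
      rw [ht]
      exact hxy
    · exact absurd t.2 (by simp [hj])
  · intro y
    refine ⟨fun j _ => if h : i = j then h ▸ y else 0, ?_⟩
    simp [f]

theorem IsSyzygy.isKerOfProj {M N : ModuleCat.{u} A} (h : IsSyzygy M N) : IsKerOfProj M N := by
  obtain ⟨P, f, hf, ⟨e⟩⟩ := h
  exact ⟨P, ⟨hf.finite, hf.projective⟩,
    (HasSES.ker f hf.surjective).congr e.symm (LinearEquiv.refl A P) (LinearEquiv.refl A M)⟩

variable [IsArtinianRing A]

/-- Induction along a decomposition into indecomposable modules. -/
theorem indec_induction {p : ModuleCat.{u} A → Prop}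
    (congr : ∀ X Y : ModuleCat.{u} A, (X ≃ₗ[A] Y) → p X → p Y)
    (zero : ∀ X : ModuleCat.{u} A, Subsingleton X → p X)
    (prod : ∀ X Y : ModuleCat.{u} A, p X → p Y → p (prodMod X Y))
    (indec : ∀ X : ModuleCat.{u} A, Module.Finite A X → IsIndec X → p X)
    (X : ModuleCat.{u} A) [hX : Module.Finite A X] : p X := by
  induction hn : Module.length A X using WellFoundedLT.induction generalizing X with
  | ind n ih =>
    by_cases h0 : Subsingleton X
    · exact zero X h0
    by_cases h1 : IsIndec X
    · exact indec X hX h1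
    simp only [IsIndec, h0, not_false_eq_true, true_and, not_forall, not_or,
      not_subsingleton_iff_nontrivial] at h1
    obtain ⟨Y, Z, ⟨e⟩, hY, hZ⟩ := h1
    have : Module.Finite A Y := ((IsSummand.fst Y Z).trans (.of_equiv e)).finite
    have : Module.Finite A Z := ((IsSummand.snd Y Z).trans (.of_equiv e)).finite
    have hl : Module.length A Y + Module.length A Z = n := by
      rw [← hn, ← e.length_eq]
      exact (Module.length_prod ..).symm
    have hYt : Module.length A Y ≠ ⊤ := Module.length_ne_top
    have hZt : Module.length A Z ≠ ⊤ := Module.length_ne_top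
    have hY0 : 0 < Module.length A Y := Module.length_pos
    have hZ0 : 0 < Module.length A Z := Module.length_pos
    refine congr _ _ e (prod Y Z (ih _ ?_ Y rfl) (ih _ ?_ Z rfl))
    · rw [← hl]
      exact (ENat.lt_add_left hYt hZ0).trans_eq (add_comm _ _)
    · rw [← hl]
      exact ENat.lt_add_left hZt hY0

/-- Up to isomorphism, a finitely generated module has only finitely many indecomposable direct
summands. -/
theorem exists_indec_family (L : ModuleCat.{u} A) [Module.Finite A L] :
    ∃ (ι : Type) (_ : Finite ι) (F : ι → ModuleCat.{u} A), (∀ i, IsSummand (F i) L) ∧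
      ∀ M : ModuleCat.{u} A, Module.Finite A M → IsIndec M → IsSummand M L →
        ∃ i, Nonempty (M ≃ₗ[A] F i) := by
  refine indec_induction (p := fun L => ∃ (ι : Type) (_ : Finite ι) (F : ι → ModuleCat.{u} A),
    (∀ i, IsSummand (F i) L) ∧ ∀ M : ModuleCat.{u} A, Module.Finite A M → IsIndec M →
      IsSummand M L → ∃ i, Nonempty (M ≃ₗ[A] F i)) ?_ ?_ ?_ ?_ L
  · rintro X Y e ⟨ι, hι, F, hF, h⟩
    exact ⟨ι, hι, F, fun i => (hF i).trans (.of_equiv e),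
      fun M hM hi hs => h M hM hi (hs.trans (.of_equiv e.symm))⟩
  · intro X hX
    refine ⟨Empty, inferInstance, Empty.elim, fun i => i.elim, fun M hM hi hs => ?_⟩
    obtain ⟨i, r, hir⟩ := hs
    refine absurd ⟨fun x y => ?_⟩ hi.1
    rw [← LinearMap.id_apply (R := A) x, ← LinearMap.id_apply (R := A) y, ← hir,
      LinearMap.comp_apply, LinearMap.comp_apply, Subsingleton.elim (i x) (i y)]
  · rintro X Y ⟨ι, hι, F, hF, h⟩ ⟨κ, hκ, G, hG, h'⟩
    refine ⟨ι ⊕ κ, inferInstance, Sum.elim F G, ?_, fun M hM hi hs => ?_⟩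
    · rintro (i | i)
      · exact (hF i).trans (.fst X Y)
      · exact (hG i).trans (.snd X Y)
    · obtain hs | hs := hi.isSummand_or hs
      · obtain ⟨i, hi⟩ := h M hM hi hs
        exact ⟨Sum.inl i, hi⟩
      · obtain ⟨i, hi⟩ := h' M hM hi hs
        exact ⟨Sum.inr i, hi⟩
  · intro X hX hi
    refine ⟨Unit, inferInstance, fun _ => X, fun _ => .refl X, fun M hM hi' hs => ⟨(), ?_⟩⟩
    obtain ⟨j, r, hr⟩ := hs
    obtain h0 | h0 := hi.of_summand hr
    · exact absurd h0 hi'.1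
    · exact ⟨LinearEquiv.ofLinearMap j r h0 hr⟩

/-- Only existence of multiplicities is claimed: the Igusa–Todorov argument works with any choice,
so the uniqueness half of Krull–Schmidt is not needed. -/
theorem exists_multMod {ι : Type} [Finite ι] {L : ModuleCat.{u} A} {F : ι → ModuleCat.{u} A}
    (hF : ∀ M : ModuleCat.{u} A, Module.Finite A M → IsIndec M → IsSummand M L →
      ∃ i, Nonempty (M ≃ₗ[A] F i))
    (M : ModuleCat.{u} A) [Module.Finite A M] (hM : add L M) :
    ∃ a, Nonempty (M ≃ₗ[A] multMod F a) := by
  classical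
  refine indec_induction (p := fun M => add L M → ∃ a, Nonempty (M ≃ₗ[A] multMod F a))
    ?_ ?_ ?_ ?_ M hM
  · intro X Y e h hY
    obtain ⟨a, ⟨e'⟩⟩ := h (add_of_isSummand (.of_equiv e) hY)
    exact ⟨a, ⟨e.symm.trans e'⟩⟩
  · intro X hX _
    exact ⟨0, ⟨LinearEquiv.ofSubsingleton X (∀ i : ι, Fin 0 → F i)⟩⟩
  · intro X Y hX hY h
    obtain ⟨a, ⟨e⟩⟩ := hX (add_of_isSummand (.fst X Y) h)
    obtain ⟨b, ⟨e'⟩⟩ := hY (add_of_isSummand (.snd X Y) h)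
    exact ⟨a + b, ⟨(e.prodCongr e').trans (multAddEquiv F a b).symm⟩⟩
  · intro X hX hi h
    obtain ⟨i, ⟨e⟩⟩ := hF X hX hi (hi.isSummand_of_add h)
    exact ⟨Pi.single i 1, ⟨e.trans (exists_multMod_single F i).some.symm⟩⟩

/-- Every finitely generated module over an artinian ring has a projective cover. -/
theorem exists_isProjectiveCover (M : ModuleCat.{u} A) [Module.Finite A M] :
    ∃ (P : ModuleCat.{u} A) (f : P →ₗ[A] M), IsProjectiveCover f := by
  obtain ⟨n, f₀, hf₀⟩ := Module.Finite.exists_fin' A M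
  -- A projective surjecting onto M with minimal length gives the cover.
  let S : Set ℕ∞ := {l | ∃ (P : ModuleCat.{u} A) (f : P →ₗ[A] M), FGProj P ∧
    Function.Surjective f ∧ Module.length A P = l}
  have hS : S.Nonempty := ⟨_, powMod n (ModuleCat.of A A), f₀, FGProj.self.pow n, hf₀, rfl⟩
  obtain ⟨P, f, hP, hf, hl⟩ := WellFounded.min_mem wellFounded_lt S hS
  have hmin : ∀ (Q : ModuleCat.{u} A) (g : Q →ₗ[A] M), FGProj Q → Function.Surjective g →
      Module.length A P ≤ Module.length A Q := fun Q g hQ hg => by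
    rw [hl]
    exact not_lt.1 (WellFounded.not_lt_min wellFounded_lt (s := S) ⟨Q, g, hQ, hg, rfl⟩)
  obtain ⟨_, _⟩ := hP
  refine ⟨P, f, ⟨‹_›, ‹_›, hf, fun N hN => ?_⟩⟩
  have hfN : Function.Surjective (f ∘ₗ N.subtype) := by
    intro x
    obtain ⟨p, rfl⟩ := hf x
    obtain ⟨y, hy, z, hz, rfl⟩ := Submodule.mem_sup.1 (hN ▸ Submodule.mem_top : p ∈ N ⊔ _)
    exact ⟨⟨y, hy⟩, by simp [LinearMap.mem_ker.1 hz]⟩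
  obtain ⟨h, hh⟩ := Module.projective_lifting_property _ f hfN
  -- This endomorphism has image in N and satisfies f g = f. Its Fitting null part W is killed by f
  -- = f g^m, so a complement of W still surjects onto M. By minimality W vanishes, g is surjective,
  -- and N is everything.
  let g : Module.End A P := N.subtype ∘ₗ h
  have hg : f ∘ₗ g = f := hh
  obtain ⟨W, j, r, g', m, hrj, hj, h1, -⟩ := exists_fitting g
  obtain ⟨e⟩ := compl_equiv hrj
  have hgm : ∀ k, f ∘ₗ (g ^ k) = f := by
    intro k
    induction k with
    | zero => rfl
    | succ k ih =>
      rw [pow_succ]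
      change (f ∘ₗ (g ^ k)) ∘ₗ g = f
      rw [ih, hg]
  have hfj : f ∘ₗ j = 0 := by
    rw [← hgm m, LinearMap.comp_assoc, hj, LinearMap.comp_zero]
  let Q : ModuleCat.{u} A := ModuleCat.of A (LinearMap.ker r)
  have hQs : IsSummand Q P := (IsSummand.snd W Q).trans (.of_equiv e)
  have hQ : FGProj Q := by
    obtain ⟨s, t, hst⟩ := hQs
    exact ⟨Module.Finite.of_surjective t
      (Function.RightInverse.surjective (LinearMap.congr_fun hst)),
      Module.Projective.of_split s t hst⟩
  have hfQ : Function.Surjective (f ∘ₗ (LinearMap.ker r).subtype) := by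
    intro x
    obtain ⟨p, rfl⟩ := hf x
    refine ⟨⟨p - j (r p), ?_⟩, ?_⟩
    · rw [LinearMap.mem_ker, map_sub]
      exact sub_eq_zero.2 (LinearMap.congr_fun hrj (r p)).symm
    · change f (p - j (r p)) = f p
      rw [map_sub]
      exact sub_eq_self.2 (LinearMap.congr_fun hfj (r p))
  have hle := hmin Q _ hQ hfQ
  have hker : LinearMap.ker r = ⊤ := by
    by_contra hne
    exact absurd (Submodule.length_lt hne) (not_lt.2 hle)
  have hr : r = 0 := LinearMap.ker_eq_top.1 hker
  rw [hr, LinearMap.comp_zero, sub_zero] at h1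
  rw [eq_top_iff]
  intro x _
  have : g (g' x) = x := LinearMap.congr_fun h1 x
  rw [← this]
  exact (h (g' x)).2

theorem exists_isSyzygy (M : ModuleCat.{u} A) [Module.Finite A M] : ∃ N, IsSyzygy M N := by
  obtain ⟨P, f, hf⟩ := exists_isProjectiveCover M
  exact ⟨ModuleCat.of A (LinearMap.ker f), P, f, hf, ⟨LinearEquiv.refl A _⟩⟩

end KrullSchmidt

/-! ### Projective dimension, Ext and the Igusa–Todorov bound. -/

section ProjectiveDimension

open Abelian

variable {A : Type u} [Ring A]

theorem shortExact_mk {X Y Z : ModuleCat.{u} A} {f : X →ₗ[A] Y} {g : Y →ₗ[A] Z}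
    (hf : Function.Injective f) (hfg : Function.Exact f g) (hg : Function.Surjective g) :
    (ShortComplex.mk (ModuleCat.ofHom f) (ModuleCat.ofHom g)
      (by rw [← ModuleCat.ofHom_comp, hfg.linearMap_comp_eq_zero]; rfl)).ShortExact :=
  ModuleCat.shortComplex_shortExact _ hfg hf hg

theorem HasSES.pd_mid {X Y Z : ModuleCat.{u} A} {n : ℕ} (h : HasSES X Y Z)
    (hX : HasProjectiveDimensionLT X n) (hZ : HasProjectiveDimensionLT Z n) :
    HasProjectiveDimensionLT Y n := by
  obtain ⟨f, g, hf, hfg, hg⟩ := h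
  exact (shortExact_mk hf hfg hg).hasProjectiveDimensionLT_X₂ n hX hZ

theorem HasSES.pd_right {X Y Z : ModuleCat.{u} A} {n : ℕ} (h : HasSES X Y Z)
    (hX : HasProjectiveDimensionLT X n) (hY : HasProjectiveDimensionLT Y (n + 1)) :
    HasProjectiveDimensionLT Z (n + 1) := by
  obtain ⟨f, g, hf, hfg, hg⟩ := h
  exact (shortExact_mk hf hfg hg).hasProjectiveDimensionLT_X₃ n hX hY

theorem HasSES.pd_left {X Y Z : ModuleCat.{u} A} {n : ℕ} (h : HasSES X Y Z)
    (hY : HasProjectiveDimensionLT Y n) (hZ : HasProjectiveDimensionLT Z (n + 1)) :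
    HasProjectiveDimensionLT X n := by
  obtain ⟨f, g, hf, hfg, hg⟩ := h
  exact (shortExact_mk hf hfg hg).hasProjectiveDimensionLT_X₁ n hY hZ

theorem IsSummand.pd {X Y : ModuleCat.{u} A} {n : ℕ} (h : IsSummand X Y)
    (hY : HasProjectiveDimensionLT Y n) : HasProjectiveDimensionLT X n :=
  (isSummand_iff.1 h).some.hasProjectiveDimensionLT n

theorem pd_one_iff {P : ModuleCat.{u} A} :
    HasProjectiveDimensionLT P 1 ↔ Module.Projective A P := by
  rw [← projective_iff_hasProjectiveDimensionLT_one, IsProjective.iff_projective]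

theorem pd_mono {X : ModuleCat.{u} A} {m n : ℕ} (h : HasProjectiveDimensionLT X m)
    (hmn : m ≤ n) : HasProjectiveDimensionLT X n :=
  hasProjectiveDimensionLT_of_ge X m n hmn

theorem pd_of_subsingleton (X : ModuleCat.{u} A) [Subsingleton X] (n : ℕ) :
    HasProjectiveDimensionLT X n :=
  pd_mono (ModuleCat.isZero_of_subsingleton X).hasProjectiveDimensionLT_zero (Nat.zero_le n)

theorem IsNthSyzygy.pd_of_syzygy {m n : ℕ} {M N : ModuleCat.{u} A} (h : IsNthSyzygy n M N)
    (hN : HasProjectiveDimensionLT N m) : HasProjectiveDimensionLT M (m + n) := by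
  induction n generalizing m N with
  | zero => exact (IsSummand.of_equiv h.some).pd hN
  | succ n ih =>
    obtain ⟨K, hK, P, hP, h⟩ := h
    rw [Nat.add_comm n 1, ← Nat.add_assoc]
    exact ih hK (h.pd_right hN (pd_mono (pd_one_iff.2 hP.2) (Nat.le_add_left 1 m)))

/-- The conclusion stops at `m + 1`: an arbitrary resolution may leave projective summands, so a
syzygy can be made projective but not zero. -/
theorem IsNthSyzygy.pd_syzygy {m n : ℕ} {M N : ModuleCat.{u} A} (h : IsNthSyzygy n M N)
    (hM : HasProjectiveDimensionLT M (m + n + 1)) : HasProjectiveDimensionLT N (m + 1) := by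
  induction n generalizing m N with
  | zero => exact (IsSummand.of_equiv h.some.symm).pd hM
  | succ n ih =>
    obtain ⟨K, hK, P, hP, h⟩ := h
    have := ih (m := m + 1) hK (by rwa [Nat.add_right_comm m 1 n, Nat.add_assoc m n 1])
    exact h.pd_left (pd_mono (pd_one_iff.2 hP.2) (Nat.le_add_left 1 m)) this

section ExtPull

universe w

variable [HasExt.{w} (ModuleCat.{u} A)]

/-- The map `Ext^i(Y, T) → Ext^i(X, T)` induced by a linear map `X → Y`. -/
noncomputable def extPull {X Y : ModuleCat.{u} A} (f : X →ₗ[A] Y) {T : ModuleCat.{u} A} {i : ℕ}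
    (x : Ext.{w} Y T i) : Ext.{w} X T i :=
  (Ext.mk₀ (ModuleCat.ofHom f)).comp x (zero_add i)

theorem extPull_comp {X Y Z : ModuleCat.{u} A} (f : X →ₗ[A] Y) (g : Y →ₗ[A] Z)
    {T : ModuleCat.{u} A} {i : ℕ} (x : Ext.{w} Z T i) :
    extPull (g ∘ₗ f) x = extPull f (extPull g x) := by
  rw [extPull, extPull, extPull, Ext.mk₀_comp_mk₀_assoc, ← ModuleCat.ofHom_comp]

theorem extPull_id {X T : ModuleCat.{u} A} {i : ℕ} (x : Ext.{w} X T i) :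
    extPull LinearMap.id x = x :=
  Ext.mk₀_id_comp x

theorem extPull_add {X Y T : ModuleCat.{u} A} (f g : X →ₗ[A] Y) {i : ℕ} (x : Ext.{w} Y T i) :
    extPull (f + g) x = extPull f x + extPull g x := by
  rw [extPull, ModuleCat.ofHom_add, Ext.mk₀_add, Ext.add_comp]
  rfl

theorem extPull_zero_map {X Y T : ModuleCat.{u} A} {i : ℕ} (x : Ext.{w} Y T i) :
    extPull (0 : X →ₗ[A] Y) x = 0 := by
  rw [extPull, ModuleCat.ofHom_zero, Ext.mk₀_zero, Ext.zero_comp]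

theorem extPull_zero {X Y T : ModuleCat.{u} A} (f : X →ₗ[A] Y) {i : ℕ} :
    extPull f (0 : Ext.{w} Y T i) = 0 :=
  Ext.comp_zero ..

/-- If `e` acts as zero on `Ext`, then `1 - e` acts as the identity. -/
theorem extPull_one_sub {X T : ModuleCat.{u} A} {e : Module.End A X} {i : ℕ} {x : Ext.{w} X T i}
    (he : extPull e x = 0) : extPull (1 - e : Module.End A X) x = x := by
  have := extPull_add (1 - e : Module.End A X) e x
  rw [he, add_zero, sub_add_cancel] at this
  exact this.symm.trans (extPull_id x)

/-- In positive degrees Ext vanishes on `P`, so a class on `X ⊕ P` is recovered from its restriction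
to `X`. -/
theorem extPull_fst_inl {X P T : ModuleCat.{u} A} [Module.Projective A P] {i : ℕ} (hi : 1 ≤ i)
    (y : Ext.{w} (prodMod X P) T i) :
    extPull (LinearMap.fst A X P : prodMod X P →ₗ[A] X)
      (extPull (LinearMap.inl A X P : X →ₗ[A] prodMod X P) y) = y := by
  have hP : HasProjectiveDimensionLT P 1 := pd_one_iff.2 inferInstance
  have h1 : extPull (LinearMap.inr A X P : P →ₗ[A] prodMod X P) y = 0 :=
    Ext.eq_zero_of_hasProjectiveDimensionLT _ 1 hi
  have h2 : (LinearMap.inl A X P ∘ₗ LinearMap.fst A X P : prodMod X P →ₗ[A] prodMod X P) +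
      (LinearMap.inr A X P ∘ₗ LinearMap.snd A X P : prodMod X P →ₗ[A] prodMod X P) =
      LinearMap.id := by
    refine LinearMap.ext fun x => ?_
    change (x.1, (0 : P)) + ((0 : X), x.2) = x
    simp
  have h3 := extPull_add
    (LinearMap.inl A X P ∘ₗ LinearMap.fst A X P : prodMod X P →ₗ[A] prodMod X P)
    (LinearMap.inr A X P ∘ₗ LinearMap.snd A X P : prodMod X P →ₗ[A] prodMod X P) y
  rw [h2, extPull_id, extPull_comp, extPull_comp (X := prodMod X P) (Y := P), h1, extPull_zero,
    add_zero] at h3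
  exact h3.symm

end ExtPull

/-- If `0 → V → V ⊕ P → Z → 0` is exact with `P` projective and `Z` of finite projective
dimension, then the projective dimension of `Z` is controlled by that of a direct summand of `V`
of finite projective dimension. -/
theorem HasSES.exists_summand_pd {V P Z : ModuleCat.{u} A} [IsArtinian A V] [IsNoetherian A V]
    [Module.Projective A P] (h : HasSES V (prodMod V P) Z) {n : ℕ}
    (hZ : HasProjectiveDimensionLT Z n) :
    ∃ W, IsSummand W V ∧ (∃ k, HasProjectiveDimensionLT W k) ∧
      ∀ D, 1 ≤ D → HasProjectiveDimensionLT W D → HasProjectiveDimensionLT Z (D + 1) := by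
  let := HasExt.standard (ModuleCat.{u} A)
  obtain ⟨s, q, hs, hsq, hq⟩ := h
  have hS := shortExact_mk hs hsq hq
  -- In positive degrees Ext identifies V ⊕ P with V, and f then induces the same map as s. The
  -- summand W is the part on which f is nilpotent.
  let f : Module.End A V := LinearMap.fst A V P ∘ₗ s
  have hf : ∀ {T : ModuleCat.{u} A} {i : ℕ} (x : Ext V T i),
      extPull f x = extPull s (extPull (LinearMap.fst A V P : prodMod V P →ₗ[A] V) x) :=
    fun x => extPull_comp s _ x
  obtain ⟨W, j, r, g, m, hrj, hj, hfg, hgf⟩ := exists_fitting f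
  refine ⟨W, ⟨j, r, hrj⟩, ⟨max n 1, ?_⟩, fun D hD hW => ?_⟩
  · rw [hasProjectiveDimensionLT_iff]
    intro i hi T x
    -- Vanishing of Ext^(i+1)(Z, T) makes f, hence f^m, surjective on Ext^i(V, T). As f^m is zero on
    -- W, this forces Ext^i(W, T) = 0.
    have hsurj : ∀ x : Ext V T i, ∃ y, extPull f y = x := by
      intro x
      obtain ⟨y, hy⟩ := Ext.contravariant_sequence_exact₁ hS _ x rfl
        (Ext.eq_zero_of_hasProjectiveDimensionLT (X := Z) _ n (by omega))
      refine ⟨extPull (LinearMap.inl A V P : V →ₗ[A] prodMod V P) y, ?_⟩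
      rw [hf, extPull_fst_inl (by omega)]
      exact hy
    have hsurj' : ∀ (k : ℕ) (x : Ext V T i), ∃ y, extPull (f ^ k) y = x := by
      intro k
      induction k with
      | zero => exact fun x => ⟨x, extPull_id x⟩
      | succ k ih =>
        intro x
        obtain ⟨y, rfl⟩ := ih x
        obtain ⟨z, rfl⟩ := hsurj y
        refine ⟨z, ?_⟩
        rw [pow_succ']
        exact extPull_comp (f ^ k) f z
    obtain ⟨y, hy⟩ := hsurj' m (extPull r x)
    rw [← extPull_id x, ← hrj, extPull_comp, ← hy, ← extPull_comp, hj, extPull_zero_map]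
  -- From degree D on, the projection to W acts as zero, so f is invertible on Ext with inverse
  -- induced by g. The long exact sequence then kills Ext of Z above degree D.
  · have he : ∀ {T : ModuleCat.{u} A} {i : ℕ} (_ : D ≤ i) (x : Ext V T i),
        extPull (j ∘ₗ r) x = 0 := by
      intro T i hi x
      rw [extPull_comp, Ext.eq_zero_of_hasProjectiveDimensionLT (extPull j x) D hi, extPull_zero]
    rw [hasProjectiveDimensionLT_iff]
    intro i hi T z
    have hz : extPull q z = 0 := by
      set y := extPull q z with hy
      have h0 : extPull s y = 0 := by
        rw [hy, ← extPull_comp, hsq.linearMap_comp_eq_zero, extPull_zero_map]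
      rw [← extPull_fst_inl (by omega) y] at h0 ⊢
      rw [← hf] at h0
      set x := extPull (LinearMap.inl A V P : V →ₗ[A] prodMod V P) y
      have : x = 0 := by
        rw [← extPull_one_sub (he (by omega) x), ← hfg]
        exact (extPull_comp g f x).trans (by rw [h0, extPull_zero])
      rw [this, extPull_zero]
    obtain ⟨i, rfl⟩ : ∃ k, i = 1 + k := ⟨i - 1, by omega⟩
    obtain ⟨x, rfl⟩ := Ext.contravariant_sequence_exact₃ hS _ z hz rfl
    have hx : x = extPull s (extPull (LinearMap.fst A V P : prodMod V P →ₗ[A] V)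
        (extPull g x)) := by
      rw [← hf]
      refine Eq.trans ?_ (extPull_comp f g x)
      refine Eq.trans ?_ (congrArg (fun e : Module.End A V => extPull e x) hgf.symm)
      exact (extPull_one_sub (he (by omega) x)).symm
    rw [hx]
    exact ShortComplex.ShortExact.extClass_comp_assoc hS _

variable [IsArtinianRing A]

/-- Only finitely many indecomposables occur in `add L`, and those of infinite projective dimension
cannot be summands of such a `W`; the maximum over the others works. -/
theorem exists_pd_bound_of_add (L : ModuleCat.{u} A) [Module.Finite A L] :
    ∃ D, ∀ W : ModuleCat.{u} A, add L W → (∃ n, HasProjectiveDimensionLT W n) →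
      HasProjectiveDimensionLT W D := by
  obtain ⟨ι, hι, F, -, hF⟩ := exists_indec_family L
  have := Fintype.ofFinite ι
  have hd : ∀ i, ∃ d, (∃ n, HasProjectiveDimensionLT (F i) n) →
      HasProjectiveDimensionLT (F i) d := by
    intro i
    by_cases h : ∃ n, HasProjectiveDimensionLT (F i) n
    · exact ⟨h.choose, fun _ => h.choose_spec⟩
    · exact ⟨0, fun h' => absurd h' h⟩
  choose d hd using hd
  refine ⟨Finset.univ.sup d, fun W hW => ?_⟩
  have := finite_of_add hW
  refine indec_induction (p := fun W => add L W → (∃ n, HasProjectiveDimensionLT W n) →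
      HasProjectiveDimensionLT W (Finset.univ.sup d)) ?_ ?_ ?_ ?_ W hW
  · rintro X Y e h hY ⟨n, hn⟩
    exact (IsSummand.of_equiv e.symm).pd
      (h (add_of_isSummand (.of_equiv e) hY) ⟨n, (IsSummand.of_equiv e).pd hn⟩)
  · intro X hX _ _
    exact pd_of_subsingleton X _
  · rintro X Y hX hY h ⟨n, hn⟩
    exact (HasSES.inl_snd X Y).pd_mid
      (hX (add_of_isSummand (.fst X Y) h) ⟨n, (IsSummand.fst X Y).pd hn⟩)
      (hY (add_of_isSummand (.snd X Y) h) ⟨n, (IsSummand.snd X Y).pd hn⟩)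
  · rintro X hX hi h ⟨n, hn⟩
    obtain ⟨i, ⟨e⟩⟩ := hF X hX hi (hi.isSummand_of_add h)
    exact (IsSummand.of_equiv e).pd (pd_mono (hd i ⟨n, (IsSummand.of_equiv e.symm).pd hn⟩)
      (Finset.le_sup (Finset.mem_univ i)))

/-- The differences of multiplicity vectors of modules having a common `n`-th syzygy. -/
def syzygyRelations {ι : Type} [Finite ι] (F : ι → ModuleCat.{u} A)
    (hF : ∀ i, Module.Finite A (F i)) (n : ℕ) : AddSubgroup (ι → ℤ) where
  carrier := {v | ∃ (a b : ι → ℕ) (U : ModuleCat.{u} A), (∀ i, v i = a i - b i) ∧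
    IsNthSyzygy n (multMod F a) U ∧ IsNthSyzygy n (multMod F b) U}
  zero_mem' := by
    have : Module.Finite A (multMod F 0) := by
      have := Fintype.ofFinite ι
      exact Module.Finite.pi
    obtain ⟨U, hU⟩ := exists_isNthSyzygy n (multMod F 0)
    exact ⟨0, 0, U, by simp, hU, hU⟩
  neg_mem' := by
    rintro v ⟨a, b, U, hv, ha, hb⟩
    exact ⟨b, a, U, fun i => by simp [hv i], hb, ha⟩
  add_mem' := by
    rintro v w ⟨a, b, U, hv, ha, hb⟩ ⟨a', b', U', hw, ha', hb'⟩
    exact ⟨a + a', b + b', prodMod U U', fun i => by simp [hv i, hw i]; ring,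
      (ha.prod ha').congr_left (multAddEquiv F a a').symm,
      (hb.prod hb').congr_left (multAddEquiv F b b').symm⟩

/-- A syzygy of a common syzygy is again common. -/
theorem syzygyRelations_mono {ι : Type} [Finite ι] (F : ι → ModuleCat.{u} A)
    (hF : ∀ i, Module.Finite A (F i)) : Monotone (syzygyRelations F hF) := by
  refine monotone_nat_of_le_succ fun n => ?_
  rintro v ⟨a, b, U, hv, ha, hb⟩
  have : Module.Finite A (multMod F a) := by
    have := Fintype.ofFinite ι
    exact Module.Finite.pi
  have := ha.finite
  obtain ⟨U', hU'⟩ := exists_isKerOfProj U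
  exact ⟨a, b, U', hv, ⟨U, ha, hU'⟩, ⟨U, hb, hU'⟩⟩

/-- The Igusa–Todorov bound: cokernels of finite projective dimension of monomorphisms in `add L`
have bounded projective dimension. -/
theorem exists_pd_bound_of_hasSES (L : ModuleCat.{u} A) [Module.Finite A L] :
    ∃ D, ∀ X Y Z : ModuleCat.{u} A, HasSES X Y Z → add L X → add L Y →
      (∃ n, HasProjectiveDimensionLT Z n) → HasProjectiveDimensionLT Z D := by
  obtain ⟨ι, hι, F, hFL, hF⟩ := exists_indec_family L
  have hFf : ∀ i, Module.Finite A (F i) := fun i => (hFL i).finite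
  have := Fintype.ofFinite ι
  obtain ⟨N, hN⟩ := monotone_stabilizes_iff_noetherian.2
    (inferInstanceAs (IsNoetherian ℤ (ι → ℤ)))
    ⟨fun n => AddSubgroup.toIntSubmodule (syzygyRelations F hFf n),
      fun m n h => AddSubgroup.toIntSubmodule.monotone (syzygyRelations_mono F hFf h)⟩
  have hstab : ∀ n, syzygyRelations F hFf n ≤ syzygyRelations F hFf N := by
    intro n
    have h1 := hN (max n N) (le_max_right _ _)
    have h2 : syzygyRelations F hFf N = syzygyRelations F hFf (max n N) :=
      AddSubgroup.toIntSubmodule.injective h1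
    rw [h2]
    exact syzygyRelations_mono F hFf (le_max_left _ _)
  obtain ⟨L', hL'⟩ := exists_isNthSyzygy N L
  have := hL'.finite
  obtain ⟨D, hD⟩ := exists_pd_bound_of_add (prodMod L' (ModuleCat.of A A))
  -- `max D 1` keeps to positive Ext degrees, the 1 passes from W to the cokernel, and N undoes the
  -- syzygies.
  refine ⟨max D 1 + 1 + N, fun X Y Z h hX hY ⟨n, hn⟩ => ?_⟩
  have := finite_of_add hX
  have := finite_of_add hY
  have := h.finite_right
  obtain ⟨a, ⟨ea⟩⟩ := exists_multMod hF X hX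
  obtain ⟨b, ⟨eb⟩⟩ := exists_multMod hF Y hY
  have hab : (fun i => (a i - b i : ℤ)) ∈ syzygyRelations F hFf N := by
    -- Here n depends on Z, but stabilization replaces n + 1 by the uniform N. The (n+1)-st syzygy
    -- of Z is projective, so the sequence of syzygies splits; a positive index lets the syzygies of
    -- X and Y absorb the projective summands.
    refine hstab (n + 1) ?_
    obtain ⟨X', hX'⟩ := exists_isNthSyzygy (n + 1) X
    obtain ⟨Y', hY'⟩ := exists_isNthSyzygy (n + 1) Y
    obtain ⟨P, Z', hP, hs, hZ'⟩ := h.horseshoe_iterate hX' hY'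
    have hZp : Module.Projective A Z' :=
      pd_one_iff.1 (hZ'.pd_syzygy (m := 0) (pd_mono hn (by omega)))
    obtain ⟨e⟩ := hs.split
    exact ⟨a, b, prodMod Y' P, fun _ => rfl,
      ((hX'.prod_fgProj ⟨hZ'.finite, hZp⟩).congr_right e).congr_left ea,
      (hY'.prod_fgProj hP).congr_left eb⟩
  obtain ⟨a', b', U, hv, ha', hb'⟩ := hab
  have hsum : b + a' = a + b' := by
    funext i
    have : (a i - b i : ℤ) = a' i - b' i := hv i
    simp only [Pi.add_apply]
    omega
  obtain ⟨Y', hY'⟩ := exists_isNthSyzygy N Y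
  let T := multMod F b'
  have hT : add L T := add_multMod hFL b'
  have hVY : IsNthSyzygy N (prodMod Y T) (prodMod Y' U) := hY'.prod hb'
  -- Since a + b' = b + a', X ⊕ T is isomorphic to Y ⊕ F^a', and F^a' shares the syzygy U with T =
  -- F^b'. No cancellation is needed.
  have hVX : IsNthSyzygy N (prodMod X T) (prodMod Y' U) := by
    have e₁ : prodMod Y (multMod F a') ≃ₗ[A] multMod F (b + a') :=
      LinearEquiv.trans (LinearEquiv.prodCongr eb (LinearEquiv.refl A (multMod F a')))
        (multAddEquiv F b a').symm
    have e₂ : multMod F (a + b') ≃ₗ[A] prodMod X T :=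
      (multAddEquiv F a b').trans (LinearEquiv.prodCongr ea.symm (LinearEquiv.refl A T))
    rw [hsum] at e₁
    exact (hY'.prod ha').congr_left (e₁.trans e₂)
  have hs : HasSES (prodMod X T) (prodMod Y T) Z :=
    (h.prod (HasSES.quotient T ⊤)).congr
      (LinearEquiv.prodCongr (LinearEquiv.refl A X) Submodule.topEquiv)
      (LinearEquiv.refl A _) (prodZeroEquiv Z _)
  obtain ⟨P, Z', hP, hs', hZ'⟩ := hs.horseshoe_iterate hVX hVY
  have hV : add (prodMod L' (ModuleCat.of A A)) (prodMod Y' U) :=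
    add_of_isNthSyzygy (add_prod hY hT) hVY hL'
  have := finite_of_add hV
  have := hP.2
  obtain ⟨W, hW, hWk, hWD⟩ := hs'.exists_summand_pd
    (pd_mono (hZ'.pd_syzygy (m := n) (pd_mono hn (by omega))) le_rfl)
  exact hZ'.pd_of_syzygy (hWD _ (le_max_right _ _)
    (pd_mono (hD W (add_of_isSummand hW hV) hWk) (le_max_left _ _)))

end ProjectiveDimension

/-! ### Socles and powers of the radical. -/

section Socle

variable {A : Type u} [Ring A]

theorem socle_isSemisimple (M : Type u) [AddCommGroup M] [Module A M] :
    IsSemisimpleModule A (socle A M) := by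
  rw [socle, sSup_eq_iSup]
  refine isSemisimpleModule_biSup_of_isSemisimpleModule_submodule fun S hS => ?_
  have : IsSimpleModule A S := hS
  infer_instance

theorem le_socle {M : Type u} [AddCommGroup M] [Module A M] (N : Submodule A M)
    [IsSemisimpleModule A N] : N ≤ socle A M := by
  have h := congrArg (Submodule.map N.subtype) (IsSemisimpleModule.sSup_simples_eq_top A N)
  rw [Submodule.map_subtype_top, (Submodule.gc_map_comap N.subtype).l_sSup] at h
  rw [← h]
  refine iSup₂_le fun S hS => le_sSup ?_
  have : IsSimpleModule A S := hS
  exact IsSimpleModule.congr (Submodule.equivMapOfInjective _ N.subtype_injective S).symm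

/-- `I` annihilates `M`. -/
def IsKilledBy (I : Ideal A) (M : ModuleCat.{u} A) : Prop := ∀ a ∈ I, ∀ x : M, a • x = 0

theorem IsSummand.isKilledBy {I : Ideal A} {X Y : ModuleCat.{u} A} (h : IsSummand X Y)
    (hY : IsKilledBy I Y) : IsKilledBy I X := by
  obtain ⟨i, r, h⟩ := h
  intro a ha x
  have hx : r (i x) = x := LinearMap.congr_fun h x
  rw [← hx, ← map_smul, hY a ha, map_zero]

theorem isKilledBy_socle (M : ModuleCat.{u} A) :
    IsKilledBy (Ring.jacobson A) (ModuleCat.of A (socle A M)) := by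
  have := socle_isSemisimple (A := A) M
  exact fun a ha x => Module.mem_annihilator.1
    (IsSemisimpleModule.jacobson_le_annihilator A (socle A M) ha) x

variable [IsArtinianRing A]

theorem isSemisimple_of_isKilledBy {M : ModuleCat.{u} A}
    (h : IsKilledBy (Ring.jacobson A) M) : IsSemisimpleModule A M := by
  have h' : Module.IsTorsionBySet A M (Ring.jacobson A : Set A) := fun x a => h a a.2 x
  let := h'.module
  exact h'.isSemisimpleModule_iff.1 inferInstance

/-- The submodule J^k M is killed by J, hence semisimple, hence contained in soc M. -/
theorem IsKilledBy.quotient_socle {k : ℕ} {M : ModuleCat.{u} A}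
    (h : IsKilledBy (Ring.jacobson A ^ (k + 1)) M) :
    IsKilledBy (Ring.jacobson A ^ k) (ModuleCat.of A (M ⧸ socle A M)) := by
  intro a ha x
  obtain ⟨x, rfl⟩ := Submodule.Quotient.mk_surjective _ x
  rw [← Submodule.Quotient.mk_smul]
  refine (Submodule.Quotient.mk_eq_zero _).2 ?_
  let N : Submodule A M := Ring.jacobson A ^ k • ⊤
  have hN : IsKilledBy (Ring.jacobson A) (ModuleCat.of A N) := by
    rintro b hb ⟨y, hy⟩
    refine Subtype.ext ?_
    have hmem : b • y ∈ Ring.jacobson A • N := Submodule.smul_mem_smul hb hy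
    have hbot : Ring.jacobson A • N = ⊥ := by
      rw [← Submodule.mul_smul, ← Ideal.IsTwoSided.pow_succ, eq_bot_iff, Submodule.smul_le]
      exact fun c hc z _ => h c hc z
    rw [hbot] at hmem
    exact hmem
  have : IsSemisimpleModule A N := isSemisimple_of_isKilledBy hN
  exact le_socle N (Submodule.smul_mem_smul ha trivial)

/-- A presentation by `A^n` factors through the semisimple module (A/J)^n, where the surjection onto
`M` splits. -/
theorem add_of_isKilledBy {M : ModuleCat.{u} A} [Module.Finite A M]
    (h : IsKilledBy (Ring.jacobson A) M) :
    add (ModuleCat.of A (A ⧸ Ring.jacobson A)) M := by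
  obtain ⟨n, f, hf⟩ := Module.Finite.exists_fin' A M
  have hJ : IsSemisimpleModule A (A ⧸ Ring.jacobson A) := by
    refine isSemisimple_of_isKilledBy (M := ModuleCat.of A (A ⧸ Ring.jacobson A)) ?_
    intro a ha x
    obtain ⟨x, rfl⟩ := Submodule.Quotient.mk_surjective _ x
    rw [← Submodule.Quotient.mk_smul]
    exact (Submodule.Quotient.mk_eq_zero _).2 (Ideal.mul_mem_right _ _ ha)
  let g : (Fin n → A ⧸ Ring.jacobson A) →ₗ[A] M := ∑ i,
    (Submodule.liftQ (Ring.jacobson A) (LinearMap.toSpanSingleton A M (f (Pi.single i 1)))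
      (fun a ha => by simpa using h a ha _)) ∘ₗ LinearMap.proj i
  have hg : Function.Surjective g := by
    intro y
    obtain ⟨x, rfl⟩ := hf y
    refine ⟨fun i => Submodule.Quotient.mk (x i), ?_⟩
    simp only [g, LinearMap.sum_apply, LinearMap.comp_apply, LinearMap.proj_apply,
      Submodule.liftQ_apply, LinearMap.toSpanSingleton_apply]
    conv_rhs => rw [pi_eq_sum_univ' x, map_sum]
    refine Finset.sum_congr rfl fun i _ => ?_
    rw [map_smul]
  obtain ⟨s, hs⟩ := IsSemisimpleModule.lifting_property g hg LinearMap.id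
  exact add_iff.2 ⟨n, s, g, hs⟩

end Socle

/-! ### The two implications. -/

section Main

variable {A : Type u} [Ring A]

theorem projectiveDimension_lt_top_iff {M : ModuleCat.{u} A} :
    projectiveDimension M < ⊤ ↔ ∃ n, HasProjectiveDimensionLT M n := by
  rw [lt_top_iff_ne_top, projectiveDimension_ne_top_iff]
  exact ⟨fun ⟨n, h⟩ => ⟨n + 1, h⟩, fun ⟨n, h⟩ => ⟨n, pd_mono h n.le_succ⟩⟩

theorem finDim_lt_top_iff :
    finDim A < ⊤ ↔ ∃ d, ∀ M : ModuleCat.{u} A, finitePD A M → HasProjectiveDimensionLT M d := by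
  constructor
  · intro h
    obtain ⟨n, hn⟩ : ∃ n : ℕ, finDim A < n := by
      generalize finDim A = b at h
      induction b with
      | bot => exact ⟨0, WithBot.bot_lt_coe _⟩
      | coe b =>
        induction b with
        | top => exact absurd rfl h.ne
        | coe b => exact ⟨b + 1, WithBot.coe_lt_coe.2 (by exact_mod_cast b.lt_succ_self)⟩
    refine ⟨n, fun M hM => projectiveDimension_lt_iff.1 (lt_of_le_of_lt ?_ hn)⟩
    exact le_sSup ⟨M, hM, rfl⟩
  · rintro ⟨d, hd⟩
    refine lt_of_le_of_lt (b := (d : WithBot ℕ∞)) (sSup_le ?_) ?_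
    · rintro _ ⟨M, hM, rfl⟩
      exact (projectiveDimension_lt_iff.2 (hd M hM)).le
    · exact WithBot.coe_lt_coe.2 (ENat.natCast_lt_top d)

theorem exists_isNthSyzygy_of_syzygies {X : ObjectProperty (ModuleCat.{u} A)} {s : ℕ}
    {N : ModuleCat.{u} A} (h : syzygies^[s] X N) : ∃ C, X C ∧ IsNthSyzygy s C N := by
  induction s generalizing N with
  | zero => exact ⟨N, h, ⟨LinearEquiv.refl A N⟩⟩
  | succ s ih =>
    rw [Function.iterate_succ_apply'] at h
    obtain ⟨M, hM, hN⟩ := h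
    obtain ⟨C, hC, hCM⟩ := ih hM
    exact ⟨C, hC, M, hCM, hN.isKerOfProj⟩

variable [IsArtinianRing A]

/-- Minimal syzygies are required by the definition of `syzygies`; this is where existence of
projective covers enters. -/
theorem exists_syzygies {X : ObjectProperty (ModuleCat.{u} A)} (s : ℕ) {C : ModuleCat.{u} A}
    [Module.Finite A C] (hC : X C) : ∃ N, syzygies^[s] X N ∧ IsNthSyzygy s C N := by
  induction s with
  | zero => exact ⟨C, hC, ⟨LinearEquiv.refl A C⟩⟩
  | succ s ih =>
    obtain ⟨M, hM, hCM⟩ := ih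
    have := hCM.finite
    obtain ⟨N, hN⟩ := exists_isSyzygy M
    refine ⟨N, ?_, M, hCM, hN.isKerOfProj⟩
    rw [Function.iterate_succ_apply']
    exact ⟨M, hM, hN⟩

theorem exists_finiteType_of_finDim_lt_top (h : finDim A < ⊤) :
    ∃ s : ℕ, IsOfFiniteRepresentationType (syzygies^[s] (classC A)) := by
  obtain ⟨d, hd⟩ := finDim_lt_top_iff.1 h
  obtain ⟨S, hS⟩ := exists_isNthSyzygy d (ModuleCat.of A (A ⧸ Ring.jacobson A))
  have := hS.finite
  refine ⟨d + 1, prodMod (prodMod S (ModuleCat.of A A)) (ModuleCat.of A A),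
    inferInstanceAs (Module.Finite A ((S × A) × A)), fun N hN => ?_⟩
  obtain ⟨C, ⟨-, M, hM, hC⟩, hCN⟩ := exists_isNthSyzygy_of_syzygies hN
  have := hM.1
  obtain ⟨T, hT⟩ := exists_isNthSyzygy d (ModuleCat.of A (socle A M))
  obtain ⟨M', hM'⟩ := exists_isNthSyzygy d M
  have : Module.Finite A (ModuleCat.of A (M ⧸ socle A M)) :=
    inferInstanceAs (Module.Finite A (M ⧸ socle A M))
  obtain ⟨P, U, hP, hs, hU⟩ := (HasSES.quotient M (socle A M)).horseshoe_iterate hT hM'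
  have hM'p : FGProj M' :=
    ⟨hM'.finite, pd_one_iff.1 (hM'.pd_syzygy (m := 0) (pd_mono (hd M hM) (by omega)))⟩
  -- The middle term is projective, so T = Ω^d(soc M) is itself one further syzygy of M/soc M.
  have hUT : IsNthSyzygy (d + 1) (ModuleCat.of A (M ⧸ socle A M)) T := ⟨U, hU, _, hM'p.prod hP, hs⟩
  have hTS : add (prodMod S (ModuleCat.of A A)) T :=
    add_of_isNthSyzygy (add_of_isKilledBy (isKilledBy_socle M)) hT hS
  refine add_trans ?_ (add_of_isNthSyzygy hC hCN hUT)
  exact add_prod (add_prod_left hTS) (add_prod_right (add_self _))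

/-- If `Ω^s(𝒞)` lies in `add L` and the modules of finite projective dimension killed by `J^k` have
bounded projective dimension, then for all `M` of finite projective dimension such that `J^k` kills
`M / soc M`, some fixed syzygy of `M / soc M` lies in a fixed class `add L'`. -/
theorem exists_syzygy_mem_add {s d k : ℕ} {L : ModuleCat.{u} A} [Module.Finite A L]
    (hL : syzygies^[s] (classC A) ≤ add L)
    (hd : ∀ M : ModuleCat.{u} A, finitePD A M → IsKilledBy (Ring.jacobson A ^ k) M →
      HasProjectiveDimensionLT M d) :
    ∃ L' : ModuleCat.{u} A, Module.Finite A L' ∧ ∀ M : ModuleCat.{u} A, finitePD A M →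
      IsKilledBy (Ring.jacobson A ^ k) (ModuleCat.of A (M ⧸ socle A M)) →
      ∃ N, IsNthSyzygy (s + d) (ModuleCat.of A (M ⧸ socle A M)) N ∧ add L' N := by
  obtain ⟨L₁, hL₁⟩ := exists_isNthSyzygy d L
  have := hL₁.finite
  refine ⟨prodMod L₁ (ModuleCat.of A A), inferInstanceAs (Module.Finite A (L₁ × A)),
    fun M hM hk => ?_⟩
  have := hM.1
  set U := ModuleCat.of A (M ⧸ socle A M) with hU
  have : Module.Finite A U := inferInstanceAs (Module.Finite A (M ⧸ socle A M))
  refine indec_induction (p := fun X => IsSummand X U → ∃ N, IsNthSyzygy (s + d) X N ∧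
    add (prodMod L₁ (ModuleCat.of A A)) N) ?_ ?_ ?_ ?_ U (.refl U)
  · intro X Y e h hY
    obtain ⟨N, hN, hN'⟩ := h ((IsSummand.of_equiv e).trans hY)
    exact ⟨N, hN.congr_left e, hN'⟩
  · intro X hX _
    obtain ⟨N, hN⟩ := exists_isNthSyzygy (s + d) X
    have hNp : Module.Projective A N :=
      pd_one_iff.1 (hN.pd_syzygy (m := 0) (pd_of_subsingleton X _))
    exact ⟨N, hN, add_prod_right (FGProj.mem_add ⟨hN.finite, hNp⟩)⟩
  · intro X Y hX hY h
    obtain ⟨N, hN, hN'⟩ := hX ((IsSummand.fst X Y).trans h)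
    obtain ⟨K, hK, hK'⟩ := hY ((IsSummand.snd X Y).trans h)
    exact ⟨_, hN.prod hK, add_prod hN' hK'⟩
  · intro X hX hi h
    -- With finite projective dimension, the bound for modules killed by J^k makes the syzygy
    -- projective; otherwise X belongs to 𝒞 and the hypothesis on Ω^s applies.
    by_cases hpd : projectiveDimension X < ⊤
    · obtain ⟨N, hN⟩ := exists_isNthSyzygy (s + d) X
      have hNp : Module.Projective A N := pd_one_iff.1 (hN.pd_syzygy (m := 0)
        (pd_mono (hd X ⟨hX, hpd⟩ (h.isKilledBy hk)) (by omega)))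
      exact ⟨N, hN, add_prod_right (FGProj.mem_add ⟨hN.finite, hNp⟩)⟩
    · have hC : classC A X := ⟨⟨hX, hi.indecomposable, not_lt_top_iff.1 hpd⟩, M, hM,
        add_of_isSummand h (add_self U)⟩
      obtain ⟨N, hN, hXN⟩ := exists_syzygies s hC
      have := hXN.finite
      obtain ⟨N', hN'⟩ := exists_isNthSyzygy d N
      exact ⟨N', hXN.trans hN', add_of_isNthSyzygy (hL N hN) hN' hL₁⟩

/-- The induction on `k` works because passing to M/soc M lowers the power of J needed to kill the
module. -/
theorem exists_pd_bound_of_isKilledBy {s : ℕ} {L : ModuleCat.{u} A} [Module.Finite A L]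
    (hL : syzygies^[s] (classC A) ≤ add L) (k : ℕ) :
    ∃ d, ∀ M : ModuleCat.{u} A, finitePD A M → IsKilledBy (Ring.jacobson A ^ k) M →
      HasProjectiveDimensionLT M d := by
  induction k with
  | zero =>
    refine ⟨0, fun M _ hM => ?_⟩
    have : Subsingleton M := ⟨fun x y => by
      have h1 : ∀ z : M, z = 0 := fun z => by
        simpa using hM 1 (by rw [Submodule.pow_zero, Ideal.one_eq_top]; trivial) z
      rw [h1 x, h1 y]⟩
    exact pd_of_subsingleton M 0
  | succ k ih =>
    obtain ⟨d, hd⟩ := ih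
    -- One extra syzygy is requested: it is spent on the rotation 0 → Ω(M/soc M) → soc M ⊕ P → M →
    -- 0, leaving s + d to apply to that sequence.
    obtain ⟨L', hL'f, hL'⟩ := exists_syzygy_mem_add hL
      (d := d + 1) fun M hM hk => pd_mono (hd M hM hk) d.le_succ
    obtain ⟨S, hS⟩ := exists_isNthSyzygy (s + d) (ModuleCat.of A (A ⧸ Ring.jacobson A))
    have := hS.finite
    let L₂ := prodMod L' (prodMod S (ModuleCat.of A A))
    have : Module.Finite A L₂ := inferInstanceAs (Module.Finite A (L' × S × A))
    obtain ⟨D, hD⟩ := exists_pd_bound_of_hasSES L₂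
    refine ⟨D + (s + d), fun M hM hk => ?_⟩
    have := hM.1
    obtain ⟨N, hN, hNL⟩ := hL' M hM hk.quotient_socle
    rw [← Nat.add_assoc, Nat.add_comm (s + d) 1] at hN
    obtain ⟨U', hU', hN⟩ := hN.exists_split
    obtain ⟨P, hP, hU'⟩ := isNthSyzygy_one.1 hU'
    have := hP.2
    have hs := (HasSES.quotient M (socle A M)).rotate hU'
    obtain ⟨T, hT⟩ := exists_isNthSyzygy (s + d) (ModuleCat.of A (socle A M))
    have := hP.1
    obtain ⟨Q, hQ⟩ := exists_isNthSyzygy (s + d) P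
    have hQp : FGProj Q := ⟨hQ.finite, pd_one_iff.1
      (hQ.pd_syzygy (m := 0) (pd_mono (pd_one_iff.2 hP.2) (by omega)))⟩
    obtain ⟨P', M', hP', hs', hM'⟩ := hs.horseshoe_iterate hN (hT.prod hQ)
    have hTS : add (prodMod S (ModuleCat.of A A)) T :=
      add_of_isNthSyzygy (add_of_isKilledBy (isKilledBy_socle M)) hT hS
    obtain ⟨n, hn⟩ := projectiveDimension_lt_top_iff.1 hM.2
    refine hM'.pd_of_syzygy (hD _ _ _ hs' (add_prod_left hNL) (add_prod_right ?_)
      ⟨n + 1, hM'.pd_syzygy (pd_mono hn (by omega))⟩)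
    exact add_prod (add_prod hTS (add_prod_right hQp.mem_add)) (add_prod_right hP'.mem_add)

theorem finDim_lt_top_of_finiteType {s : ℕ}
    (h : IsOfFiniteRepresentationType (syzygies^[s] (classC A))) : finDim A < ⊤ := by
  obtain ⟨L, hLf, hL⟩ := h
  obtain ⟨k, hk⟩ := IsSemiprimaryRing.isNilpotent (R := A)
  obtain ⟨d, hd⟩ := exists_pd_bound_of_isKilledBy hL k
  refine finDim_lt_top_iff.2 ⟨d, fun M hM => hd M hM fun a ha x => ?_⟩
  rw [hk] at ha
  rw [(Submodule.mem_bot A).1 ha, zero_smul]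

end Main

end ArtinAlg

/-- For an artin algebra `A` (a finitely generated algebra over a commutative artinian ring `R`),
the finitistic dimension is finite iff `Ω^s(𝒞(A))` is of finite representation type for
some `s ≥ 0`. -/
theorem mainTheorem9 {R : Type*} {A : Type u} [CommRing R] [IsArtinianRing R] [Ring A]
    [Algebra R A] [Module.Finite R A] :
    ArtinAlg.finDim A < ⊤ ↔
      ∃ s : ℕ, ArtinAlg.IsOfFiniteRepresentationType
        (ArtinAlg.syzygies^[s] (ArtinAlg.classC A)) := by
  have : IsArtinianRing A := IsArtinianRing.of_finite R A
  exact ⟨ArtinAlg.exists_finiteType_of_finDim_lt_top,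
    fun ⟨_, h⟩ => ArtinAlg.finDim_lt_top_of_finiteType h⟩
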